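/- **Darboux transformation of the position vector.** Let $K\in\{0,1,-1\}$, let $R_{2n+1}(K)$ be $\mathbf R^{2n+1}$ with inner product $x_1y_1+\dots+x_{2n}y_{2n}+x_{2n+1}y_{2n+1}$ for $K=0,1$ and $x_1y_1+\dots+x_{2n}y_{2n}-x_{2n+1}y_{2n+1}$ for $K=-1$, and let $M_{2n}(K)\subset R_{2n+1}(K)$ be $\{x_{2n+1}=0\}$ for $K=0$ and $\{x\cdot x=K\}$ for $K=\pm1$. Let $U\subset\mathbf R^n$ be open; all functions below are smooth on $U$, and $\partial_i=\partial/\partial x_i$. Consider the following equations. * (GC), for real functions $\rho_i$ (possibly with zeros) and $\gamma_{ij}$ with $\gamma_{ii}=0$: for $i\ne j$, $\partial_i\gamma_{ij}+\partial_j\gamma_{ji}=\sum_{l\ne i,j}\gamma_{li}\gamma_{lj}$; $\partial_k\gamma_{ij}+\gamma_{ik}\gamma_{kj}=0$ for $k\neq i,j$; $\partial_i\gamma_{ji}+\partial_j\gamma_{ij}-\sum_{l\ne i,j}\gamma_{il}\gamma_{jl}-K\rho_i\rho_j=0$; $\partial_j\rho_i+\gamma_{ij}\rho_j=0$. * ($\Omega$),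 for $\omega=(\omega_{i\alpha}):U\to O(n)$: $\partial_j\omega_{i\alpha}+\gamma_{ij}\omega_{j\alpha}=0$ $(i\ne j)$, $\partial_i\omega_{i\alpha}=\sum_{k\ne i}\gamma_{ki}\omega_{k\alpha}$. * (L$_\lambda$), for $(u_i,v_i,w)$: $\partial_iu_i=\sum_{k\ne i}\gamma_{ki}u_k-\lambda v_i$, $\partial_ju_i=-\gamma_{ij}u_j$, $\partial_iv_i=\sum_{k\ne i}\gamma_{ik}v_k+\lambda u_i-K\rho_iw$, $\partial_jv_i=-\gamma_{ji}v_j$ $(i\neq j)$, $\partial_iw=\rho_iv_i$. A *frame* for $(\rho,\gamma)$ consists of $\vec p_i,\vec q_i,\vec r:U\to R_{2n+1}(K)$ $(1\le i\le n)$ such that $\vec r\in M_{2n}(K)$, the vectors $\vec p_1,\dots,\vec p_n,\vec q_1,\dots,\vec q_n$ are an orthonormal basis of $T_{\vec r}M_{2n}(K)$, and $(\vec p_i,\vec q_i,\vec r)$ solves (L$_1$) (the structure equations). (a) Let $\vec V:U\to M_{2n}(K)$ be an immersion with parallel orthonormal normal fields $\vec n_1,\dots,\vec n_n$, first fundamental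 form $\sum_i\rho_i^2dx_i^2$ $(\rho_i\ne0)$ and second fundamental form $\sum_{i,\alpha}\rho_i\omega_{i\alpha}dx_i^2\,\vec n_\alpha$, $\omega\in O(n)$. Put $\gamma_{ij}=-\partial_j\rho_i/\rho_j$ $(i\ne j)$, $\gamma_{ii}=0$, $\vec p_i=\sum_\alpha\omega_{i\alpha}\vec n_\alpha$, $\vec q_i=\rho_i^{-1}\partial_i\vec V$, $\vec r=\vec V$. Then (GC) and ($\Omega$) hold and $(\vec p,\vec q,\vec r)$ is a frame for $(\rho,\gamma)$. (b) Let $(\rho,\gamma)$ solve (GC), let $\mu\in\mathbf R$, and let $\xi_i,\eta_i,\zeta$ be real functions such that $H=(\xi_1,\dots,\xi_n,\sqrt{-1}\eta_1,\dots,\sqrt{-1}\eta_n,\sqrt{-1}\zeta)^T$ solves (L$_\lambda$) with $\lambda=\sqrt{-1}\mu$, $\sum_i\xi_i^2=\sum_i\eta_i^2+K\zeta^2$, and $\varDelta=\sum_l\xi_l^2$ has no zero on $U$. Put $b=\frac{2\mu}{1+\mu^2}$, $C=\mathrm{diag}(1,\dots,1,1,\dots,1,K)$, $\sigma=\mathrm{diag}(1,\dots,1,-1,\dots,-1,-1)$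 (blocks $n,n,1$) and $$G(\lambda)=\frac1{\lambda^2+\mu^2}\Big(\lambda^2+\frac{2\sqrt{-1}\lambda\mu}{H^*CH}[\sigma,HH^*]\sigma C-\frac{2\mu^2}{H^*CH}(\sigma HH^*+HH^*\sigma)\sigma C+\mu^2\Big).$$ 1. $\widetilde\rho_i=\rho_i-\frac{2\mu\zeta\xi_i}{\varDelta}$, $\widetilde\gamma_{ij}=\gamma_{ij}+\frac{2\mu\xi_i\eta_j}{\varDelta}$ $(i\ne j)$, $\widetilde\gamma_{ii}=0$ solve (GC). 2. If $\omega$ solves ($\Omega$) for $\gamma$, then $\widetilde\omega_{i\alpha}=\omega_{i\alpha}-\sum_j\frac{2\xi_i\xi_j}{\varDelta}\omega_{j\alpha}$ has values in $O(n)$ and solves ($\Omega$) for $\widetilde\gamma$; if $\mu\ne0$, $\widetilde\omega=G(0)_{[1,1]}\omega$, where $G(0)_{[1,1]}$ is the upper left $n\times n$ block of $G(0)$. 3. If $(\vec p,\vec q,\vec r)$ is a frame for $(\rho,\gamma)$, then $(\widetilde{\vec p},\widetilde{\vec q},\widetilde{\vec r})^T=G(1)(\vec p,\vec q,\vec r)^T$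 is given by $$\widetilde{\vec p}_i=\vec p_i-\sum_j\frac{b\mu\xi_i\xi_j}\varDelta\vec p_j-\sum_j\frac{b\xi_i\eta_j}\varDelta\vec q_j-\frac{Kb\zeta\xi_i}\varDelta\vec r,$$ $$\widetilde{\vec q}_i=\vec q_i+\sum_j\frac{b\eta_i\xi_j}\varDelta\vec p_j-\sum_j\frac{b\mu\eta_i\eta_j}\varDelta\vec q_j-\frac{Kb\mu\zeta\eta_i}\varDelta\vec r,$$ $$\widetilde{\vec r}=\vec r+\sum_j\frac{b\zeta\xi_j}\varDelta\vec p_j-\sum_j\frac{b\mu\zeta\eta_j}\varDelta\vec q_j-\frac{Kb\mu\zeta^2}\varDelta\vec r,$$ and it is a frame for $(\widetilde\rho,\widetilde\gamma)$; in particular it solves the new structure equations. 4. If moreover $\omega$ solves ($\Omega$) for $\gamma$, then on the set of points of $U$ where all $\widetilde\rho_i\ne0$, $\widetilde{\vec r}$ is an immersion into $M_{2n}(K)$ whose induced metric has constant curvature $K$, with flat normal bundle and linearly independent curvature normals; its first and second fundamental forms are $\sum_i\widetilde\rho_i^2dx_i^2$ and $\sum_{i,\alpha}\widetilde\rho_i\widetilde\omega_{i\alpha}dx_i^2\,\widetilde{\vec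 n}_\alpha$ for the parallel orthonormal normal fields $\widetilde{\vec n}_\alpha=\sum_i\widetilde\omega_{i\alpha}\widetilde{\vec p}_i$. 5. At every point where all $\rho_i\ne0$, $\widetilde{\vec V}=\widetilde{\vec r}$ is given in terms of $\vec V=\vec r$ by $$\widetilde{\vec V}=\sum_j\frac{b\zeta\xi_j}{\varDelta\rho_j}\frac{\partial^2\vec V}{\partial x_j^2}+\sum_j\frac{b\zeta}{\varDelta\rho_j^2}\Big(-\xi_j\partial_j\rho_j+\sum_{k\ne j}\xi_k\partial_j\rho_k-\mu\rho_j\eta_j\Big)\frac{\partial\vec V}{\partial x_j}+\Big(1-\frac{Kb\mu\zeta^2}\varDelta+\sum_j\frac{Kb\zeta\rho_j\xi_j}\varDelta\Big)\vec V.$$ -/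

import Mathlib

namespace SpaceFormDarboux

noncomputable section

/-- The coordinate space in which the local coordinates `x₁, …, xₙ` vary. -/
abbrev Coord (n : ℕ) : Type := Fin n → ℝ

/-- The ambient linear space `R_{2n+1}(K)`, as a vector space. -/
abbrev Ambient (n : ℕ) : Type := Fin (2 * n + 1) → ℝ

/-- The partial derivative `∂ᵢ f`. -/
def pd {n : ℕ} {F : Type*} [NormedAddCommGroup F] [NormedSpace ℝ F]
    (i : Fin n) (f : Coord n → F) (x : Coord n) : F :=
  fderiv ℝ f x (Pi.single i 1)

/-! ### The space forms -/

/-- The inner product of `R_{2n+1}(K)`: Euclidean for `K = 0, 1`, and Lorentzian, with negative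
last direction, for `K = -1`. -/
def ambientInner {n : ℕ} (K : ℝ) (x y : Ambient n) : ℝ :=
  (∑ a : Fin (2 * n), x a.castSucc * y a.castSucc)
    + (if K = -1 then -1 else 1) * (x (Fin.last (2 * n)) * y (Fin.last (2 * n)))

/-- The standard model of `M_{2n}(K)` in `R_{2n+1}(K)`: a hyperplane for `K = 0`, and the quadric
`x · x = K` for `K = ±1`. -/
def spaceForm (n : ℕ) (K : ℝ) : Set (Ambient n) :=
  {x | (K = 0 → x (Fin.last (2 * n)) = 0) ∧ (K ≠ 0 → ambientInner K x x = K)}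

/-- The tangent space of `M_{2n}(K)` at `y`. -/
def spaceFormTangent {n : ℕ} (K : ℝ) (y : Ambient n) : Set (Ambient n) :=
  {X | (K = 0 → X (Fin.last (2 * n)) = 0) ∧ (K ≠ 0 → ambientInner K y X = 0)}

/-! ### Geometry of an immersion in coordinates -/

/-- The Christoffel symbols `Γᵏᵢⱼ` of a metric `g`. -/
def christoffel {n : ℕ} (g : Coord n → Matrix (Fin n) (Fin n) ℝ) (k i j : Fin n)
    (x : Coord n) : ℝ :=
  (1 / 2) * ∑ l, (g x)⁻¹ k l *
    (pd i (fun y => g y j l) x + pd j (fun y => g y i l) x - pd l (fun y => g y i j) x)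

/-- The curvature components `Rˡₖᵢⱼ`, where `R(∂ᵢ, ∂ⱼ)∂ₖ = ∑ₗ Rˡₖᵢⱼ ∂ₗ`. -/
def riemann {n : ℕ} (g : Coord n → Matrix (Fin n) (Fin n) ℝ) (l k i j : Fin n)
    (x : Coord n) : ℝ :=
  pd i (christoffel g l j k) x - pd j (christoffel g l i k) x
    + ∑ m, (christoffel g l i m x * christoffel g m j k x
          - christoffel g l j m x * christoffel g m i k x)

/-- The metric `g` has constant curvature `K`: `R(X, Y)Z = K (g(Y, Z) X - g(X, Z) Y)`. -/
def HasConstantCurvature {n : ℕ} (K : ℝ) (U : Set (Coord n))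
    (g : Coord n → Matrix (Fin n) (Fin n) ℝ) : Prop :=
  ∀ x ∈ U, ∀ l k i j : Fin n, riemann g l k i j x =
    K * (g x j k * (if l = i then 1 else 0) - g x i k * (if l = j then 1 else 0))

/-- The first fundamental form of `V`. -/
def inducedMetric {n : ℕ} (K : ℝ) (V : Coord n → Ambient n) (x : Coord n) :
    Matrix (Fin n) (Fin n) ℝ :=
  Matrix.of fun i j => ambientInner K (pd i V x) (pd j V x)

/-- The normal space, in the tangent space of `M_{2n}(K)`, of the immersion `V` at `x`. -/
def normalSpace {n : ℕ} (K : ℝ) (V : Coord n → Ambient n) (x : Coord n) : Set (Ambient n) :=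
  {ν | ν ∈ spaceFormTangent K (V x) ∧ ∀ i, ambientInner K ν (pd i V x) = 0}

/-- `e₁, …, eₙ` is a smooth orthonormal frame of the normal bundle, parallel for the normal
connection. -/
structure IsParallelNormalFrame {n : ℕ} (K : ℝ) (U : Set (Coord n)) (V : Coord n → Ambient n)
    (e : Fin n → Coord n → Ambient n) : Prop where
  smooth : ∀ α, ContDiffOn ℝ ((⊤ : ℕ∞) : WithTop ℕ∞) (e α) U
  normal : ∀ x ∈ U, ∀ α, e α x ∈ normalSpace K V x
  orthonormal : ∀ x ∈ U, ∀ α β, ambientInner K (e α x) (e β x) = if α = β then 1 else 0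
  parallel : ∀ x ∈ U, ∀ α i, ∀ ν ∈ normalSpace K V x, ambientInner K (pd i (e α) x) ν = 0

/-- The normal bundle is flat: it has parallel orthonormal frames near every point. -/
def HasFlatNormalBundle {n : ℕ} (K : ℝ) (U : Set (Coord n)) (V : Coord n → Ambient n) : Prop :=
  ∀ x ∈ U, ∃ N : Set (Coord n), IsOpen N ∧ x ∈ N ∧ N ⊆ U ∧
    ∃ e : Fin n → Coord n → Ambient n, IsParallelNormalFrame K N V e

/-- `h` is a curvature normal of `V` at `x`: there is a tangent vector `X ≠ 0` such that
`II(X, Y) = g(X, Y) h` for all tangent vectors `Y` (both sides are normal vectors, tested here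
against all normal vectors `ν`). -/
def IsCurvatureNormal {n : ℕ} (K : ℝ) (V : Coord n → Ambient n) (x : Coord n)
    (h : Ambient n) : Prop :=
  h ∈ normalSpace K V x ∧ ∃ X : Fin n → ℝ, X ≠ 0 ∧
    ∀ Y : Fin n → ℝ, ∀ ν ∈ normalSpace K V x,
      ∑ i, ∑ j, X i * Y j * ambientInner K (pd i (pd j V) x) ν =
        (∑ i, ∑ j, X i * Y j * inducedMetric K V x i j) * ambientInner K h ν

/-- `V` is a smooth isometric immersion of a piece of a space form `M_n(K)` into `M_{2n}(K)` with
flat normal bundle and linearly independent curvature normals. -/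
structure IsSpaceFormImmersion {n : ℕ} (K : ℝ) (U : Set (Coord n))
    (V : Coord n → Ambient n) : Prop where
  smooth : ContDiffOn ℝ ((⊤ : ℕ∞) : WithTop ℕ∞) V U
  mem : ∀ x ∈ U, V x ∈ spaceForm n K
  immersion : ∀ x ∈ U, LinearIndependent ℝ (fun i => pd i V x)
  curvature : HasConstantCurvature K U (inducedMetric K V)
  flat : HasFlatNormalBundle K U V
  curvatureNormals : ∀ x ∈ U,
    LinearIndependent ℝ (fun h : {h : Ambient n // IsCurvatureNormal K V x h} => h.1)

/-- `V` is an immersion into `M_{2n}(K)`, with parallel orthonormal normal frame `e₁, …, eₙ`, and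
`I = ∑ ρᵢ² dxᵢ²`, `II = ∑ ρᵢ ω_{iα} dxᵢ² e_α` with `ω` in `O(n)`. -/
structure HasPrincipalForms {n : ℕ} (K : ℝ) (U : Set (Coord n)) (V : Coord n → Ambient n)
    (ρ : Fin n → Coord n → ℝ) (ω : Coord n → Matrix (Fin n) (Fin n) ℝ)
    (e : Fin n → Coord n → Ambient n) : Prop where
  smooth : ContDiffOn ℝ ((⊤ : ℕ∞) : WithTop ℕ∞) V U
  smooth_rho : ∀ i, ContDiffOn ℝ ((⊤ : ℕ∞) : WithTop ℕ∞) (ρ i) U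
  smooth_omega : ∀ i α, ContDiffOn ℝ ((⊤ : ℕ∞) : WithTop ℕ∞) (fun x => ω x i α) U
  mem : ∀ x ∈ U, V x ∈ spaceForm n K
  rho_ne_zero : ∀ x ∈ U, ∀ i, ρ i x ≠ 0
  orthogonal : ∀ x ∈ U, ω x ∈ Matrix.orthogonalGroup (Fin n) ℝ
  frame : IsParallelNormalFrame K U V e
  first : ∀ x ∈ U, ∀ i j, inducedMetric K V x i j = if i = j then ρ i x ^ 2 else 0
  second : ∀ x ∈ U, ∀ i j α, ambientInner K (pd i (pd j V) x) (e α x) =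
    if i = j then ρ i x * ω x i α else 0

/-! ### The integrable system -/

/-- The Gauss-Codazzi equations for `(ρᵢ)` and `(γᵢⱼ)`, with the convention `γᵢᵢ = 0`. The `ρᵢ` may
have zeros. -/
structure GaussCodazzi {n : ℕ} (K : ℝ) (U : Set (Coord n)) (ρ : Fin n → Coord n → ℝ)
    (γ : Fin n → Fin n → Coord n → ℝ) : Prop where
  smooth_rho : ∀ i, ContDiffOn ℝ ((⊤ : ℕ∞) : WithTop ℕ∞) (ρ i) U
  smooth_gamma : ∀ i j, ContDiffOn ℝ ((⊤ : ℕ∞) : WithTop ℕ∞) (γ i j) U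
  diag : ∀ x ∈ U, ∀ i, γ i i x = 0
  eq₁ : ∀ x ∈ U, ∀ i j, i ≠ j →
    pd i (γ i j) x + pd j (γ j i) x
      = ∑ l ∈ (Finset.univ.erase i).erase j, γ l i x * γ l j x
  eq₂ : ∀ x ∈ U, ∀ i j k, i ≠ j → i ≠ k → j ≠ k →
    pd k (γ i j) x + γ i k x * γ k j x = 0
  eq₃ : ∀ x ∈ U, ∀ i j, i ≠ j →
    pd i (γ j i) x + pd j (γ i j) x
      - (∑ l ∈ (Finset.univ.erase i).erase j, γ i l x * γ j l x) - K * ρ i x * ρ j x = 0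
  eq₄ : ∀ x ∈ U, ∀ i j, i ≠ j → pd j (ρ i) x + γ i j x * ρ j x = 0

/-- The Codazzi equations for the `O(n)`-valued map `ω`. -/
structure OmegaSystem {n : ℕ} (U : Set (Coord n)) (γ : Fin n → Fin n → Coord n → ℝ)
    (ω : Coord n → Matrix (Fin n) (Fin n) ℝ) : Prop where
  smooth : ∀ i α, ContDiffOn ℝ ((⊤ : ℕ∞) : WithTop ℕ∞) (fun x => ω x i α) U
  orthogonal : ∀ x ∈ U, ω x ∈ Matrix.orthogonalGroup (Fin n) ℝ
  offdiag : ∀ x ∈ U, ∀ i j α, i ≠ j → pd j (fun y => ω y i α) x + γ i j x * ω x j α = 0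
  diag : ∀ x ∈ U, ∀ i α,
    pd i (fun y => ω y i α) x = ∑ k ∈ Finset.univ.erase i, γ k i x * ω x k α

/-- The linear system with spectral parameter `lam` (in `𝕜`) for smooth functions
`u₁, …, uₙ, v₁, …, vₙ, w` with values in a vector space `F`. -/
structure LaxSystem {n : ℕ} {𝕜 F : Type*} [Field 𝕜] [NormedAddCommGroup F] [NormedSpace ℝ F]
    [Module 𝕜 F] (K : ℝ) (U : Set (Coord n)) (ρ : Fin n → Coord n → ℝ)
    (γ : Fin n → Fin n → Coord n → ℝ) (lam : 𝕜) (u v : Fin n → Coord n → F) (w : Coord n → F) :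
    Prop where
  smooth_u : ∀ i, ContDiffOn ℝ ((⊤ : ℕ∞) : WithTop ℕ∞) (u i) U
  smooth_v : ∀ i, ContDiffOn ℝ ((⊤ : ℕ∞) : WithTop ℕ∞) (v i) U
  smooth_w : ContDiffOn ℝ ((⊤ : ℕ∞) : WithTop ℕ∞) w U
  u_diag : ∀ x ∈ U, ∀ i,
    pd i (u i) x = (∑ k ∈ Finset.univ.erase i, γ k i x • u k x) - lam • v i x
  u_offdiag : ∀ x ∈ U, ∀ i j, i ≠ j → pd j (u i) x = -(γ i j x • u j x)
  v_diag : ∀ x ∈ U, ∀ i,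
    pd i (v i) x = (∑ k ∈ Finset.univ.erase i, γ i k x • v k x) + lam • u i x
      - (K * ρ i x) • w x
  v_offdiag : ∀ x ∈ U, ∀ i j, i ≠ j → pd j (v i) x = -(γ j i x • v j x)
  w_eq : ∀ x ∈ U, ∀ i, pd i w x = ρ i x • v i x

/-- A frame `(p, q, r)` of an immersion: the point `r` lies on `M_{2n}(K)`, the vectors
`p₁, …, pₙ, q₁, …, qₙ` are an orthonormal basis of the tangent space of `M_{2n}(K)` at `r`, and the
structure equations, i.e. the linear system at spectral parameter `1`, hold. -/
structure IsMovingFrame {n : ℕ} (K : ℝ) (U : Set (Coord n)) (ρ : Fin n → Coord n → ℝ)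
    (γ : Fin n → Fin n → Coord n → ℝ) (p q : Fin n → Coord n → Ambient n)
    (r : Coord n → Ambient n) : Prop where
  structure_eq : LaxSystem K U ρ γ (1 : ℝ) p q r
  mem : ∀ x ∈ U, r x ∈ spaceForm n K
  p_tangent : ∀ x ∈ U, ∀ i, p i x ∈ spaceFormTangent K (r x)
  q_tangent : ∀ x ∈ U, ∀ i, q i x ∈ spaceFormTangent K (r x)
  inner_pp : ∀ x ∈ U, ∀ i j, ambientInner K (p i x) (p j x) = if i = j then 1 else 0
  inner_qq : ∀ x ∈ U, ∀ i j, ambientInner K (q i x) (q j x) = if i = j then 1 else 0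
  inner_pq : ∀ x ∈ U, ∀ i j, ambientInner K (p i x) (q j x) = 0

/-! ### The quantities attached to an immersion in principal coordinates -/

/-- `γᵢⱼ = -∂ⱼρᵢ / ρⱼ` for `i ≠ j`, and `γᵢᵢ = 0`. -/
def gammaOf {n : ℕ} (ρ : Fin n → Coord n → ℝ) (i j : Fin n) (x : Coord n) : ℝ :=
  if i = j then 0 else -(pd j (ρ i) x / ρ j x)

/-- `pᵢ = ∑_α ω_{iα} e_α`. -/
def pOf {n : ℕ} (ω : Coord n → Matrix (Fin n) (Fin n) ℝ) (e : Fin n → Coord n → Ambient n)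
    (i : Fin n) (x : Coord n) : Ambient n :=
  ∑ α, ω x i α • e α x

/-- `qᵢ = ρᵢ⁻¹ ∂ᵢV`. -/
def qOf {n : ℕ} (ρ : Fin n → Coord n → ℝ) (V : Coord n → Ambient n)
    (i : Fin n) (x : Coord n) : Ambient n :=
  (ρ i x)⁻¹ • pd i V x

/-- `e_α = ∑ᵢ ω_{iα} pᵢ`, the inverse of the relation `pᵢ = ∑_α ω_{iα} e_α` for `ω` in `O(n)`. -/
def normalOf {n : ℕ} (ω : Coord n → Matrix (Fin n) (Fin n) ℝ) (p : Fin n → Coord n → Ambient n)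
    (α : Fin n) (x : Coord n) : Ambient n :=
  ∑ i, ω x i α • p i x

/-! ### The Darboux matrix -/

/-- The index set of the `2n + 1` components, in blocks of sizes `n`, `n`, `1`. -/
abbrev Idx (n : ℕ) : Type := Fin n ⊕ Fin n ⊕ Unit

/-- The column `(u₁, …, uₙ, v₁, …, vₙ, w)`. -/
def column {n : ℕ} {F : Type*} (u v : Fin n → F) (w : F) : Idx n → F :=
  Sum.elim u (Sum.elim v fun _ => w)

/-- `C = diag(1, …, 1, 1, …, 1, K)`. -/
def matC (n : ℕ) (K : ℝ) : Matrix (Idx n) (Idx n) ℂ :=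
  Matrix.diagonal (column (fun _ => 1) (fun _ => 1) (K : ℂ))

/-- `σ = diag(1, …, 1, -1, …, -1, -1)`. -/
def matSigma (n : ℕ) : Matrix (Idx n) (Idx n) ℂ :=
  Matrix.diagonal (column (fun _ => 1) (fun _ => -1) (-1))

/-- The Darboux matrix
`G(λ) = (λ² + (2iλμ / H^*CH) [σ, HH^*]σC - (2μ² / H^*CH) (σHH^* + HH^*σ)σC + μ²) / (λ² + μ²)`. -/
def darbouxMatrix {ι : Type*} [Fintype ι] [DecidableEq ι] (σ C : Matrix ι ι ℂ) (μ : ℝ)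
    (H : ι → ℂ) (lam : ℂ) : Matrix ι ι ℂ :=
  (1 / (lam ^ 2 + (μ : ℂ) ^ 2)) •
    (lam ^ 2 • (1 : Matrix ι ι ℂ)
      + (2 * Complex.I * lam * μ / (star H ⬝ᵥ C.mulVec H)) •
          ((σ * Matrix.vecMulVec H (star H) - Matrix.vecMulVec H (star H) * σ) * σ * C)
      - (2 * (μ : ℂ) ^ 2 / (star H ⬝ᵥ C.mulVec H)) •
          ((σ * Matrix.vecMulVec H (star H) + Matrix.vecMulVec H (star H) * σ) * σ * C)
      + (μ : ℂ) ^ 2 • (1 : Matrix ι ι ℂ))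

/-- `H = (ξ₁, …, ξₙ, iη₁, …, iηₙ, iζ)` at the point `x`. -/
def vecH {n : ℕ} (ξ η : Fin n → Coord n → ℝ) (ζ : Coord n → ℝ) (x : Coord n) : Idx n → ℂ :=
  column (fun i => (ξ i x : ℂ)) (fun i => Complex.I * (η i x : ℂ)) (Complex.I * (ζ x : ℂ))

/-- The Darboux matrix `G(λ)` of the geometric system at the point `x`. -/
def geoDarboux {n : ℕ} (K μ : ℝ) (ξ η : Fin n → Coord n → ℝ) (ζ : Coord n → ℝ) (lam : ℂ)
    (x : Coord n) : Matrix (Idx n) (Idx n) ℂ :=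
  darbouxMatrix (matSigma n) (matC n K) μ (vecH ξ η ζ x) lam

/-- `Δ = ∑ ξ_l²`. -/
def Del {n : ℕ} (ξ : Fin n → Coord n → ℝ) (x : Coord n) : ℝ := ∑ l, ξ l x ^ 2

/-- `(ξ, iη, iζ)`, with `ξ, η, ζ` real, solves the linear system at spectral parameter `iμ`,
`∑ ξᵢ² = ∑ ηᵢ² + Kζ²`, and the denominator `Δ` of the transformation has no zero. -/
structure IsDarbouxData {n : ℕ} (K : ℝ) (U : Set (Coord n)) (ρ : Fin n → Coord n → ℝ)
    (γ : Fin n → Fin n → Coord n → ℝ) (μ : ℝ) (ξ η : Fin n → Coord n → ℝ) (ζ : Coord n → ℝ) :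
    Prop where
  lax : LaxSystem K U ρ γ (Complex.I * (μ : ℂ)) (fun i x => (ξ i x : ℂ))
    (fun i x => Complex.I * (η i x : ℂ)) (fun x => Complex.I * (ζ x : ℂ))
  quadric : ∀ x ∈ U, ∑ i, ξ i x ^ 2 = (∑ i, η i x ^ 2) + K * ζ x ^ 2
  del_ne_zero : ∀ x ∈ U, Del ξ x ≠ 0

/-! ### The explicit transformation formulas -/

/-- `b = 2μ / (1 + μ²)`. -/
def bCoeff (μ : ℝ) : ℝ := 2 * μ / (1 + μ ^ 2)

def rhoT {n : ℕ} (μ : ℝ) (ξ : Fin n → Coord n → ℝ) (ζ : Coord n → ℝ)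
    (ρ : Fin n → Coord n → ℝ) (i : Fin n) (x : Coord n) : ℝ :=
  ρ i x - 2 * μ * ζ x * ξ i x / Del ξ x

/-- The formula for `γᵢⱼ` is meant for `i ≠ j`; by convention, `γᵢᵢ = 0`. -/
def gammaT {n : ℕ} (μ : ℝ) (ξ η : Fin n → Coord n → ℝ)
    (γ : Fin n → Fin n → Coord n → ℝ) (i j : Fin n) (x : Coord n) : ℝ :=
  if i = j then 0 else γ i j x + 2 * μ * ξ i x * η j x / Del ξ x

def omegaT {n : ℕ} (ξ : Fin n → Coord n → ℝ) (ω : Coord n → Matrix (Fin n) (Fin n) ℝ)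
    (x : Coord n) : Matrix (Fin n) (Fin n) ℝ :=
  Matrix.of fun i α => ω x i α - ∑ j, 2 * ξ i x * ξ j x / Del ξ x * ω x j α

def pT {n : ℕ} (K μ : ℝ) (ξ η : Fin n → Coord n → ℝ) (ζ : Coord n → ℝ)
    (p q : Fin n → Coord n → Ambient n) (r : Coord n → Ambient n) (i : Fin n) (x : Coord n) :
    Ambient n :=
  p i x - (∑ j, (bCoeff μ * μ * ξ i x * ξ j x / Del ξ x) • p j x)
    - (∑ j, (bCoeff μ * ξ i x * η j x / Del ξ x) • q j x)
    - (K * bCoeff μ * ζ x * ξ i x / Del ξ x) • r x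

def qT {n : ℕ} (K μ : ℝ) (ξ η : Fin n → Coord n → ℝ) (ζ : Coord n → ℝ)
    (p q : Fin n → Coord n → Ambient n) (r : Coord n → Ambient n) (i : Fin n) (x : Coord n) :
    Ambient n :=
  q i x + (∑ j, (bCoeff μ * η i x * ξ j x / Del ξ x) • p j x)
    - (∑ j, (bCoeff μ * μ * η i x * η j x / Del ξ x) • q j x)
    - (K * bCoeff μ * μ * ζ x * η i x / Del ξ x) • r x

def rT {n : ℕ} (K μ : ℝ) (ξ η : Fin n → Coord n → ℝ) (ζ : Coord n → ℝ)
    (p q : Fin n → Coord n → Ambient n) (r : Coord n → Ambient n) (x : Coord n) :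
    Ambient n :=
  r x + (∑ j, (bCoeff μ * ζ x * ξ j x / Del ξ x) • p j x)
    - (∑ j, (bCoeff μ * μ * ζ x * η j x / Del ξ x) • q j x)
    - (K * bCoeff μ * μ * ζ x ^ 2 / Del ξ x) • r x

/-- The transformed position vector in terms of the old position vector `V` and its derivatives. -/
def positionT {n : ℕ} (K μ : ℝ) (ξ η : Fin n → Coord n → ℝ) (ζ : Coord n → ℝ)
    (ρ : Fin n → Coord n → ℝ) (V : Coord n → Ambient n) (x : Coord n) : Ambient n :=
  (∑ j, (bCoeff μ * ζ x * ξ j x / (Del ξ x * ρ j x)) • pd j (pd j V) x)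
    + (∑ j, (bCoeff μ * ζ x / (Del ξ x * ρ j x ^ 2) *
        (-(ξ j x * pd j (ρ j) x) + (∑ k ∈ Finset.univ.erase j, ξ k x * pd j (ρ k) x)
          - μ * ρ j x * η j x)) • pd j V x)
    + (1 - K * bCoeff μ * μ * ζ x ^ 2 / Del ξ x
        + ∑ j, K * bCoeff μ * ζ x * ρ j x * ξ j x / Del ξ x) • V x

end

end SpaceFormDarboux

open SpaceFormDarboux

/-!
The columns of `ω`, the `pᵢ` and the `ξᵢ` (and, for the transpose of `γ`, the `qᵢ` and the `ηᵢ`)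
solve systems of one shape, `∂ⱼfᵢ = -γᵢⱼfⱼ` for `i ≠ j` and `∂ⱼfⱼ = ∑ₖ γₖⱼfₖ + hⱼ`. The vectors
`P = ∑ⱼ ξⱼpⱼ` and `Q = ∑ⱼ ηⱼqⱼ + Kζr` are orthogonal and of square length `Δ`. The Darboux
transformation acts on the `pᵢ` and `qᵢ` (and on `r` if `K ≠ 0`) as the rotation by the angle
`2 arctan μ` from `Q` towards `P` in the plane of `P` and `Q`, and on the columns of `ω` as the
reflection in the hyperplane orthogonal to `ξ`; this gives orthonormality, and the new equations
follow from the derivatives of `P` and `Q`.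

For an immersion with the prescribed fundamental forms, pairing derivatives with the adapted frame
gives the off-diagonal structure equations, and orthonormality forces the diagonal ones; the
Gauss–Codazzi equations are their compatibility conditions. Conversely, rescaling by `diag(ρ)` turns
the Levi-Civita connection of `∑ᵢ ρᵢ² dxᵢ²` into the connection with coefficients `γ` on the
orthonormal frame `q`, and the Gauss equation says that its curvature is the constant `K`.
-/

namespace SpaceFormDarboux

section PartialDerivatives

variable {n : ℕ} {F G : Type*} [NormedAddCommGroup F] [NormedSpace ℝ F]
  [NormedAddCommGroup G] [NormedSpace ℝ G] {U : Set (Coord n)} {x : Coord n}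

/-- Smoothness on a set: all functions of the theory are smooth on an open set `U`. -/
abbrev SmoothOn (f : Coord n → F) (U : Set (Coord n)) : Prop :=
  ContDiffOn ℝ ((⊤ : ℕ∞) : WithTop ℕ∞) f U

/-- `f` is (Fréchet) differentiable at `x`, with partial derivative `∂ᵢ f (x) = f'`: the counterpart
for `pd` of what `HasDerivAt` is for `deriv`. -/
def HasPd (i : Fin n) (f : Coord n → F) (f' : F) (x : Coord n) : Prop :=
  ∃ L : Coord n →L[ℝ] F, HasFDerivAt f L x ∧ L (Pi.single i 1) = f'

namespace HasPd

variable {i : Fin n} {f g : Coord n → F} {f' g' : F}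

theorem pd_eq (h : HasPd i f f' x) : pd i f x = f' := by
  obtain ⟨L, hL, rfl⟩ := h
  rw [pd, hL.fderiv]

theorem unique (h : HasPd i f f' x) (h' : HasPd i f g' x) : f' = g' :=
  h.pd_eq.symm.trans h'.pd_eq

theorem congr_deriv (h : HasPd i f f' x) (e : f' = g') : HasPd i f g' x := e ▸ h

theorem congr_of_eqOn (h : HasPd i f f' x) (hU : IsOpen U) (hx : x ∈ U) (e : Set.EqOn g f U) :
    HasPd i g f' x :=
  let ⟨L, hL, hf'⟩ := h
  ⟨L, hL.congr_of_eventuallyEq (e.eventuallyEq_of_mem (hU.mem_nhds hx)), hf'⟩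

theorem const (i : Fin n) (a : F) (x : Coord n) : HasPd i (fun _ => a) 0 x :=
  ⟨0, hasFDerivAt_const a x, rfl⟩

theorem add (hf : HasPd i f f' x) (hg : HasPd i g g' x) :
    HasPd i (fun y => f y + g y) (f' + g') x := by
  obtain ⟨⟨L, hL, rfl⟩, ⟨M, hM, rfl⟩⟩ := And.intro hf hg
  exact ⟨L + M, hL.add hM, rfl⟩

theorem sub (hf : HasPd i f f' x) (hg : HasPd i g g' x) :
    HasPd i (fun y => f y - g y) (f' - g') x := by
  obtain ⟨⟨L, hL, rfl⟩, ⟨M, hM, rfl⟩⟩ := And.intro hf hg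
  exact ⟨L - M, hL.sub hM, rfl⟩

theorem sum {ι : Type*} {s : Finset ι} {f : ι → Coord n → F} {f' : ι → F}
    (h : ∀ a ∈ s, HasPd i (f a) (f' a) x) :
    HasPd i (fun y => ∑ a ∈ s, f a y) (∑ a ∈ s, f' a) x := by
  choose! L hL hf' using h
  exact ⟨∑ a ∈ s, L a, HasFDerivAt.fun_sum hL, by
    rw [sum_apply]; exact Finset.sum_congr rfl hf'⟩

theorem clm (L : F →L[ℝ] G) (hf : HasPd i f f' x) : HasPd i (fun y => L (f y)) (L f') x := by
  obtain ⟨M, hM, rfl⟩ := hf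
  exact ⟨L ∘L M, L.hasFDerivAt.comp x hM, rfl⟩

theorem bilinear {E : Type*} [NormedAddCommGroup E] [NormedSpace ℝ E] (B : E →L[ℝ] F →L[ℝ] G)
    {e : Coord n → E} {e' : E} (he : HasPd i e e' x) (hf : HasPd i f f' x) :
    HasPd i (fun y => B (e y) (f y)) (B e' (f x) + B (e x) f') x := by
  obtain ⟨⟨L, hL, rfl⟩, ⟨M, hM, rfl⟩⟩ := And.intro he hf
  exact ⟨_, B.hasFDerivAt_of_bilinear hL hM, add_comm _ _⟩

theorem smul {c : Coord n → ℝ} {c' : ℝ} (hc : HasPd i c c' x) (hf : HasPd i f f' x) :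
    HasPd i (fun y => c y • f y) (c' • f x + c x • f') x :=
  hc.bilinear (ContinuousLinearMap.lsmul ℝ ℝ) hf

theorem mul {f g : Coord n → ℝ} {f' g' : ℝ} (hf : HasPd i f f' x) (hg : HasPd i g g' x) :
    HasPd i (fun y => f y * g y) (f' * g x + f x * g') x :=
  hf.smul hg

theorem inv {f : Coord n → ℝ} {f' : ℝ} (hf : HasPd i f f' x) (h0 : f x ≠ 0) :
    HasPd i (fun y => (f y)⁻¹) (-f' / f x ^ 2) x := by
  obtain ⟨L, hL, rfl⟩ := hf
  refine ⟨_, (hasDerivAt_inv h0).comp_hasFDerivAt x hL, ?_⟩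
  rw [smul_apply, smul_eq_mul, neg_div, neg_mul, inv_mul_eq_div]

end HasPd

variable {f : Coord n → F} {f' : F} {i : Fin n}

theorem SmoothOn.hasPd (hf : SmoothOn f U) (hU : IsOpen U) (hx : x ∈ U) (i : Fin n) :
    HasPd i f (pd i f x) x :=
  ⟨_, ((hf.contDiffAt (hU.mem_nhds hx)).differentiableAt (by simp)).hasFDerivAt, rfl⟩

theorem SmoothOn.hasPd_of_eq (hf : SmoothOn f U) (hU : IsOpen U) (hx : x ∈ U)
    (h : pd i f x = f') : HasPd i f f' x :=
  (hf.hasPd hU hx i).congr_deriv h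

theorem smoothOn_pd (hf : SmoothOn f U) (hU : IsOpen U) (i : Fin n) : SmoothOn (pd i f) U :=
  (hf.fderiv_of_isOpen hU (by simp)).clm_apply contDiffOn_const

theorem pd_pd_eq_fderiv_fderiv (hf : SmoothOn f U) (hU : IsOpen U) (hx : x ∈ U) (i j : Fin n) :
    pd i (pd j f) x = fderiv ℝ (fderiv ℝ f) x (Pi.single i 1) (Pi.single j 1) := by
  have hd : DifferentiableAt ℝ (fderiv ℝ f) x :=
    ((hf.fderiv_of_isOpen (m := ((⊤ : ℕ∞) : WithTop ℕ∞)) hU (by simp)).contDiffAt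
      (hU.mem_nhds hx)).differentiableAt (by simp)
  have h := hd.hasFDerivAt.clm_apply (hasFDerivAt_const (Pi.single j (1 : ℝ) : Coord n) x)
  exact (HasPd.pd_eq ⟨_, h, rfl⟩).trans (by simp)

theorem pd_comm (hf : SmoothOn f U) (hU : IsOpen U) (hx : x ∈ U) (i j : Fin n) :
    pd i (pd j f) x = pd j (pd i f) x := by
  have hs : IsSymmSndFDerivAt ℝ f x :=
    (hf.contDiffAt (hU.mem_nhds hx)).isSymmSndFDerivAt (by
      rw [minSmoothness_of_isRCLikeNormedField]
      exact WithTop.coe_le_coe.2 (le_top : (2 : ℕ∞) ≤ ⊤))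
  rw [pd_pd_eq_fderiv_fderiv hf hU hx, pd_pd_eq_fderiv_fderiv hf hU hx]
  exact hs _ _

end PartialDerivatives

section AmbientForm

variable {n : ℕ} {K : ℝ} {f g : Coord n → Ambient n}

/-- The inner product `ambientInner K` of `R_{2n+1}(K)`, bundled as a bilinear form. -/
noncomputable def ambientForm (K : ℝ) : Ambient n →ₗ[ℝ] Ambient n →ₗ[ℝ] ℝ :=
  LinearMap.mk₂ ℝ (ambientInner K)
    (by intro a b c; simp only [ambientInner, Pi.add_apply, add_mul, Finset.sum_add_distrib]; ring)
    (by
      intro t a b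
      simp only [ambientInner, Pi.smul_apply, smul_eq_mul, mul_assoc, ← Finset.mul_sum]; ring)
    (by intro a b c; simp only [ambientInner, Pi.add_apply, mul_add, Finset.sum_add_distrib]; ring)
    (by
      intro t a b
      simp only [ambientInner, Pi.smul_apply, smul_eq_mul, mul_left_comm _ t, ← Finset.mul_sum]
      ring)

theorem ambientForm_apply (a b : Ambient n) : ambientForm K a b = ambientInner K a b := rfl

theorem ambientForm_comm (a b : Ambient n) : ambientForm K a b = ambientForm K b a := by
  simp only [ambientForm_apply, ambientInner, mul_comm]

theorem HasPd.inner {i : Fin n} {f' g' : Ambient n} {x : Coord n}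
    (hf : HasPd i f f' x) (hg : HasPd i g g' x) :
    HasPd i (fun y => ambientForm K (f y) (g y)) (ambientForm K f' (g x) + ambientForm K (f x) g')
      x :=
  hf.bilinear (ambientForm K).toContinuousBilinearMap hg

end AmbientForm

section RotationCoefficients

variable {n : ℕ} {F : Type*} [NormedAddCommGroup F] [NormedSpace ℝ F]

/-- The common shape of the systems for `(uᵢ)`, `(vᵢ)` and the columns of `ω`: the `j`-th partial
derivatives of the family `a` at `x` are
`∂ⱼaᵢ = -cᵢ aⱼ` for `i ≠ j` and `∂ⱼaⱼ = ∑_{k ≠ j} cₖ aₖ + α`.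
The entry `cⱼ` does not occur. -/
structure HasRotPd (c : Fin n → ℝ) (j : Fin n) (a : Fin n → Coord n → F) (α : F)
    (x : Coord n) : Prop where
  diag : HasPd j (a j) ((∑ k ∈ Finset.univ.erase j, c k • a k x) + α) x
  offdiag : ∀ i, i ≠ j → HasPd j (a i) (-(c i • a j x)) x

namespace HasRotPd

variable {c : Fin n → ℝ} {j : Fin n} {a : Fin n → Coord n → F} {α : F} {x : Coord n}

theorem iff_forall_hasPd : HasRotPd c j a α x ↔ ∀ i, HasPd j (a i)
    (-(c i • a j x) + if i = j then (∑ k, c k • a k x) + α else 0) x := by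
  have hsum : -(c j • a j x) + ((∑ k, c k • a k x) + α)
      = (∑ k ∈ Finset.univ.erase j, c k • a k x) + α := by
    rw [← Finset.sum_erase_add _ _ (Finset.mem_univ j)]
    abel
  constructor
  · intro h i
    rcases eq_or_ne i j with rfl | hij
    · exact h.diag.congr_deriv (by rw [if_pos rfl, hsum])
    · exact (h.offdiag i hij).congr_deriv (by rw [if_neg hij, add_zero])
  · intro h
    exact ⟨(h j).congr_deriv (by rw [if_pos rfl, hsum]),
      fun i hij => (h i).congr_deriv (by rw [if_neg hij, add_zero])⟩

theorem congr_coeff {c' : Fin n → ℝ} (h : HasRotPd c j a α x) (hc : ∀ i, i ≠ j → c' i = c i) :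
    HasRotPd c' j a α x where
  diag := h.diag.congr_deriv (by
    congr 1
    exact Finset.sum_congr rfl fun k hk => by rw [hc k (Finset.ne_of_mem_erase hk)])
  offdiag i hij := (h.offdiag i hij).congr_deriv (by rw [hc i hij])

theorem clm {G : Type*} [NormedAddCommGroup G] [NormedSpace ℝ G] (h : HasRotPd c j a α x)
    (L : F →L[ℝ] G) : HasRotPd c j (fun i y => L (a i y)) (L α) x where
  diag := (h.diag.clm L).congr_deriv (by simp only [map_add, map_sum, map_smul])
  offdiag i hij := ((h.offdiag i hij).clm L).congr_deriv (by simp only [map_neg, map_smul])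

theorem sum_smul {f : Fin n → Coord n → ℝ} {φ : ℝ} (hf : HasRotPd c j f φ x)
    (ha : HasRotPd c j a α x) :
    HasPd j (fun y => ∑ i, f i y • a i y) (φ • a j x + f j x • α) x := by
  refine (HasPd.sum fun i _ => (iff_forall_hasPd.1 hf i).smul
    (iff_forall_hasPd.1 ha i)).congr_deriv ?_
  simp only [add_smul, ite_smul, zero_smul, smul_add, smul_ite, smul_zero, Finset.sum_add_distrib,
    Finset.sum_ite_eq', Finset.mem_univ, if_true, smul_neg, neg_smul, Finset.sum_neg_distrib,
    smul_eq_mul, mul_smul, Finset.sum_smul, Finset.smul_sum]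
  simp only [smul_comm (f _ x) (c _)]
  abel

theorem sub_smul_smul {ξ : Fin n → Coord n → ℝ} {β t : ℝ} {s : F} {f : Coord n → ℝ}
    {S : Coord n → F} (ha : HasRotPd c j a α x) (hξ : HasRotPd c j ξ β x)
    (hf : HasPd j f (-(f x * (ξ j x * t))) x) (hS : HasPd j S s x) (hs : f x • s = t • a j x) :
    HasRotPd (fun i => c i + ξ i x * t) j (fun i y => a i y - (f y * ξ i y) • S y)
      (α - (f x * β) • S x - t • (∑ k, ξ k x • a k x) + (f x * t * ∑ k, ξ k x ^ 2) • S x) x := by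
  have hsum : ∑ k, (c k + ξ k x * t) • (a k x - (f x * ξ k x) • S x)
      = (∑ k, c k • a k x) - (f x * ∑ k, c k * ξ k x) • S x + t • (∑ k, ξ k x • a k x)
        - (f x * t * ∑ k, ξ k x ^ 2) • S x := by
    simp only [Finset.mul_sum, Finset.smul_sum, Finset.sum_smul, ← Finset.sum_sub_distrib,
      ← Finset.sum_add_distrib]
    exact Finset.sum_congr rfl fun k _ => by module
  have hs' (i : Fin n) : (f x * ξ i x) • s = (ξ i x * t) • a j x := by
    rw [mul_comm, mul_smul, hs, smul_smul]
  refine iff_forall_hasPd.2 fun i => ((iff_forall_hasPd.1 ha i).sub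
    ((hf.mul (iff_forall_hasPd.1 hξ i)).smul hS)).congr_deriv ?_
  rw [hsum, hs']
  simp only [smul_eq_mul]
  split_ifs <;> module

end HasRotPd

section Compatibility

variable {U : Set (Coord n)} {x : Coord n} {g : Fin n → Fin n → Coord n → ℝ}
  {a α : Fin n → Coord n → F} {i j : Fin n}

theorem HasRotPd.pd_pd_eq (hU : IsOpen U) (hg : SmoothOn (g i j) U)
    (h : ∀ x ∈ U, ∀ j, HasRotPd (fun i => g i j x) j a (α j x) x) (hx : x ∈ U) {k : Fin n}
    (hij : i ≠ j) (hjk : j ≠ k) :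
    pd k (pd j (a i)) x = -(pd k (g i j) x • a j x) + (g i j x * g j k x) • a k x := by
  have hprod := (HasPd.const k (-1 : ℝ) x).smul
    ((hg.hasPd hU hx k).smul ((h x hx k).offdiag j hjk))
  have hEq : Set.EqOn (pd j (a i)) (fun y => (-1 : ℝ) • g i j y • a j y) U := fun y hy => by
    rw [((h y hy j).offdiag i hij).pd_eq]
    exact (neg_one_smul ℝ _).symm
  rw [(hprod.congr_of_eqOn hU hx hEq).pd_eq]
  module

theorem HasRotPd.pd_add_mul_eq_zero (hU : IsOpen U) (ha : ∀ i, SmoothOn (a i) U)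
    (hg : ∀ i j, SmoothOn (g i j) U)
    (h : ∀ x ∈ U, ∀ j, HasRotPd (fun i => g i j x) j a (α j x) x) (hx : x ∈ U) {k : Fin n}
    (hij : i ≠ j) (hik : i ≠ k) (hjk : j ≠ k) (ℓ : F →ₗ[ℝ] ℝ)
    (hℓ : ∀ l, ℓ (a l x) = if l = j then 1 else 0) : pd k (g i j) x + g i k x * g k j x = 0 := by
  have hcomm := congrArg ℓ (pd_comm (ha i) hU hx k j)
  rw [pd_pd_eq hU (hg i j) h hx hij hjk, pd_pd_eq hU (hg i k) h hx hik hjk.symm] at hcomm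
  simp only [map_add, map_neg, map_smul, hℓ, if_true, if_neg hjk.symm, smul_eq_mul] at hcomm
  linarith

theorem HasRotPd.pd_add_pd_eq (hU : IsOpen U) (ha : ∀ i, SmoothOn (a i) U)
    (hg : ∀ i j, SmoothOn (g i j) U)
    (h : ∀ x ∈ U, ∀ j, HasRotPd (fun i => g i j x) j a (α j x) x) (hx : x ∈ U) (hij : i ≠ j)
    {α' : F} (hα : HasPd j (α i) α' x) (ℓ : F →ₗ[ℝ] ℝ)
    (hℓ : ∀ l, ℓ (a l x) = if l = j then 1 else 0) :
    pd i (g i j) x + pd j (g j i) x = (∑ l ∈ (Finset.univ.erase i).erase j, g l i x * g l j x)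
      - g j i x * ℓ (α j x) - ℓ α' := by
  have hdiag : HasPd j (pd i (a i)) ((∑ l ∈ Finset.univ.erase i,
      (pd j (g l i) x • a l x + g l i x • pd j (a l) x)) + α') x :=
    ((HasPd.sum fun l _ => ((hg l i).hasPd hU hx j).smul ((ha l).hasPd hU hx j)).add
      hα).congr_of_eqOn hU hx fun y hy => (h y hy i).diag.pd_eq
  have hcomm := congrArg ℓ (pd_comm (ha i) hU hx i j)
  have hjj : ℓ (pd j (a j) x) = ℓ (α j x) := by
    simp only [(h x hx j).diag.pd_eq, map_add, map_sum, map_smul, hℓ]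
    rw [Finset.sum_eq_zero fun l hl => by rw [if_neg (Finset.ne_of_mem_erase hl), smul_zero],
      zero_add]
  have hlj (l : Fin n) (hl : l ≠ j) : ℓ (pd j (a l) x) = -g l j x := by
    rw [((h x hx j).offdiag l hl).pd_eq, map_neg, map_smul, hℓ, if_pos rfl, smul_eq_mul, mul_one]
  rw [pd_pd_eq hU (hg i j) h hx hij hij.symm, hdiag.pd_eq,
    ← Finset.sum_erase_add _ _ (Finset.mem_erase.2 ⟨hij.symm, Finset.mem_univ j⟩)] at hcomm
  simp only [map_add, map_neg, map_smul, map_sum, hℓ, if_true, if_neg hij, hjj, smul_eq_mul]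
    at hcomm
  have hrest : ∑ l ∈ (Finset.univ.erase i).erase j,
      (pd j (g l i) x * (if l = j then 1 else 0) + g l i x * ℓ (pd j (a l) x))
      = -∑ l ∈ (Finset.univ.erase i).erase j, g l i x * g l j x := by
    rw [← Finset.sum_neg_distrib]
    refine Finset.sum_congr rfl fun l hl => ?_
    rw [if_neg (Finset.ne_of_mem_erase hl), hlj l (Finset.ne_of_mem_erase hl)]
    ring
  linarith

end Compatibility

end RotationCoefficients

section Systems

variable {n : ℕ} {K : ℝ} {U : Set (Coord n)} {ρ : Fin n → Coord n → ℝ}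
  {γ : Fin n → Fin n → Coord n → ℝ} {x : Coord n}

namespace LaxSystem

variable {𝕜 F : Type*} [Field 𝕜] [NormedAddCommGroup F] [NormedSpace ℝ F] [Module 𝕜 F] {lam : 𝕜}
  {u v : Fin n → Coord n → F} {w : Coord n → F}

theorem hasRotPd_u (h : LaxSystem K U ρ γ lam u v w) (hU : IsOpen U) (hx : x ∈ U) (j : Fin n) :
    HasRotPd (fun i => γ i j x) j u (-(lam • v j x)) x where
  diag := SmoothOn.hasPd_of_eq (h.smooth_u j) hU hx
    ((h.u_diag x hx j).trans (sub_eq_add_neg _ _))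
  offdiag i hij := SmoothOn.hasPd_of_eq (h.smooth_u i) hU hx (h.u_offdiag x hx i j hij)

theorem hasRotPd_v (h : LaxSystem K U ρ γ lam u v w) (hU : IsOpen U) (hx : x ∈ U) (j : Fin n) :
    HasRotPd (fun i => γ j i x) j v (lam • u j x - (K * ρ j x) • w x) x where
  diag := SmoothOn.hasPd_of_eq (h.smooth_v j) hU hx
    ((h.v_diag x hx j).trans (add_sub_assoc _ _ _))
  offdiag i hij := SmoothOn.hasPd_of_eq (h.smooth_v i) hU hx (h.v_offdiag x hx i j hij)

theorem hasPd_w (h : LaxSystem K U ρ γ lam u v w) (hU : IsOpen U) (hx : x ∈ U) (j : Fin n) :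
    HasPd j w (ρ j x • v j x) x :=
  SmoothOn.hasPd_of_eq h.smooth_w hU hx (h.w_eq x hx j)

theorem of_hasRotPd (smooth_u : ∀ i, SmoothOn (u i) U) (smooth_v : ∀ i, SmoothOn (v i) U)
    (smooth_w : SmoothOn w U)
    (hu : ∀ x ∈ U, ∀ j, HasRotPd (fun i => γ i j x) j u (-(lam • v j x)) x)
    (hv : ∀ x ∈ U, ∀ j,
      HasRotPd (fun i => γ j i x) j v (lam • u j x - (K * ρ j x) • w x) x)
    (hw : ∀ x ∈ U, ∀ j, HasPd j w (ρ j x • v j x) x) : LaxSystem K U ρ γ lam u v w where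
  smooth_u := smooth_u
  smooth_v := smooth_v
  smooth_w := smooth_w
  u_diag x hx i := (hu x hx i).diag.pd_eq.trans (sub_eq_add_neg _ _).symm
  u_offdiag x hx i j hij := ((hu x hx j).offdiag i hij).pd_eq
  v_diag x hx i := (hv x hx i).diag.pd_eq.trans (add_sub_assoc _ _ _).symm
  v_offdiag x hx i j hij := ((hv x hx j).offdiag i hij).pd_eq
  w_eq x hx i := (hw x hx i).pd_eq

end LaxSystem

namespace OmegaSystem

variable {ω : Coord n → Matrix (Fin n) (Fin n) ℝ}

theorem hasRotPd (h : OmegaSystem U γ ω) (hU : IsOpen U) (hx : x ∈ U) (j α : Fin n) :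
    HasRotPd (fun i => γ i j x) j (fun i y => ω y i α) 0 x where
  diag := SmoothOn.hasPd_of_eq (h.smooth j α) hU hx
    ((h.diag x hx j α).trans (add_zero _).symm)
  offdiag i hij := SmoothOn.hasPd_of_eq (h.smooth i α) hU hx
    (eq_neg_of_add_eq_zero_left (h.offdiag x hx i j α hij))

theorem of_hasRotPd (smooth : ∀ i α, SmoothOn (fun x => ω x i α) U)
    (orthogonal : ∀ x ∈ U, ω x ∈ Matrix.orthogonalGroup (Fin n) ℝ)
    (h : ∀ x ∈ U, ∀ j α, HasRotPd (fun i => γ i j x) j (fun i y => ω y i α) 0 x) :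
    OmegaSystem U γ ω where
  smooth := smooth
  orthogonal := orthogonal
  offdiag x hx i j α hij := by
    rw [((h x hx j α).offdiag i hij).pd_eq, smul_eq_mul, neg_add_cancel]
  diag x hx i α := by
    simp only [(h x hx i α).diag.pd_eq, add_zero, smul_eq_mul]

end OmegaSystem

namespace IsDarbouxData

variable {μ : ℝ} {ξ η : Fin n → Coord n → ℝ} {ζ : Coord n → ℝ}

theorem smoothOn_xi (h : IsDarbouxData K U ρ γ μ ξ η ζ) (i : Fin n) : SmoothOn (ξ i) U := by
  simpa only [Function.comp_def, Complex.reCLM_apply, Complex.ofReal_re] using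
    Complex.reCLM.contDiff.comp_contDiffOn (h.lax.smooth_u i)

theorem smoothOn_eta (h : IsDarbouxData K U ρ γ μ ξ η ζ) (i : Fin n) : SmoothOn (η i) U := by
  simpa only [Function.comp_def, Complex.imCLM_apply, Complex.I_mul_im, Complex.ofReal_re] using
    Complex.imCLM.contDiff.comp_contDiffOn (h.lax.smooth_v i)

theorem smoothOn_zeta (h : IsDarbouxData K U ρ γ μ ξ η ζ) : SmoothOn ζ U := by
  simpa only [Function.comp_def, Complex.imCLM_apply, Complex.I_mul_im, Complex.ofReal_re] using
    Complex.imCLM.contDiff.comp_contDiffOn h.lax.smooth_w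

theorem smoothOn_del (h : IsDarbouxData K U ρ γ μ ξ η ζ) : SmoothOn (Del ξ) U :=
  ContDiffOn.sum fun i _ => (h.smoothOn_xi i).pow 2

theorem hasRotPd_xi (h : IsDarbouxData K U ρ γ μ ξ η ζ) (hU : IsOpen U) (hx : x ∈ U)
    (j : Fin n) : HasRotPd (fun i => γ i j x) j ξ (μ * η j x) x := by
  simpa [mul_assoc, mul_left_comm _ Complex.I] using
    (h.lax.hasRotPd_u hU hx j).clm Complex.reCLM

theorem hasRotPd_eta (h : IsDarbouxData K U ρ γ μ ξ η ζ) (hU : IsOpen U) (hx : x ∈ U)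
    (j : Fin n) : HasRotPd (fun i => γ j i x) j η (μ * ξ j x - K * ρ j x * ζ x) x := by
  simpa [mul_assoc, mul_left_comm _ Complex.I] using
    (h.lax.hasRotPd_v hU hx j).clm Complex.imCLM

theorem hasPd_zeta (h : IsDarbouxData K U ρ γ μ ξ η ζ) (hU : IsOpen U) (hx : x ∈ U)
    (j : Fin n) : HasPd j ζ (ρ j x * η j x) x := by
  simpa using (h.lax.hasPd_w hU hx j).clm Complex.imCLM

theorem hasPd_del (h : IsDarbouxData K U ρ γ μ ξ η ζ) (hU : IsOpen U) (hx : x ∈ U)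
    (j : Fin n) : HasPd j (Del ξ) (2 * μ * (ξ j x * η j x)) x := by
  have hξ := h.hasRotPd_xi hU hx j
  have hsum := hξ.sum_smul hξ
  simp only [smul_eq_mul, ← sq] at hsum
  exact hsum.congr_deriv (by ring)

theorem hasPd_div_del (h : IsDarbouxData K U ρ γ μ ξ η ζ) (hU : IsOpen U) (hx : x ∈ U)
    (j : Fin n) (t : ℝ) :
    HasPd j (fun y => t / Del ξ y) (-(t / Del ξ x * (2 * μ / Del ξ x * (ξ j x * η j x)))) x := by
  have h0 := h.del_ne_zero x hx
  simp only [div_eq_mul_inv t]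
  refine ((HasPd.const j t x).mul ((h.hasPd_del hU hx j).inv h0)).congr_deriv ?_
  field_simp
  ring

end IsDarbouxData

end Systems

section SumErase

variable {ι M : Type*} [Fintype ι] [DecidableEq ι] {i j : ι}

theorem sum_erase_eq_add_left [AddCommMonoid M] (h : i ≠ j) (f : ι → M) :
    ∑ k ∈ Finset.univ.erase i, f k = (∑ k ∈ (Finset.univ.erase i).erase j, f k) + f j :=
  (Finset.sum_erase_add _ _ (Finset.mem_erase.2 ⟨h.symm, Finset.mem_univ j⟩)).symm

theorem sum_erase_eq_add_right [AddCommMonoid M] (h : i ≠ j) (f : ι → M) :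
    ∑ k ∈ Finset.univ.erase j, f k = (∑ k ∈ (Finset.univ.erase i).erase j, f k) + f i := by
  rw [Finset.erase_right_comm, sum_erase_eq_add_left h.symm]

theorem sum_erase_erase_eq_sub_sub [AddCommGroup M] (h : i ≠ j) (f : ι → M) :
    ∑ k ∈ (Finset.univ.erase i).erase j, f k = ∑ k, f k - f i - f j := by
  rw [← Finset.sum_erase_add _ _ (Finset.mem_univ i), sum_erase_eq_add_left h]
  abel

end SumErase

section GaussCodazzi

variable {n : ℕ} {K : ℝ} {U : Set (Coord n)} {ρ : Fin n → Coord n → ℝ}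
  {γ : Fin n → Fin n → Coord n → ℝ} {μ : ℝ} {ξ η : Fin n → Coord n → ℝ} {ζ : Coord n → ℝ}
  {x : Coord n} {i j : Fin n}

theorem HasPd.add_mul_mul {f g a b : Coord n → ℝ} {f' g' a' b' : ℝ} (hg : HasPd i g g' x)
    (hf : HasPd i f f' x) (ha : HasPd i a a' x) (hb : HasPd i b b' x) :
    HasPd i (fun y => g y + f y * (a y * b y))
      (g' + (f' * (a x * b x) + f x * (a' * b x + a x * b'))) x :=
  hg.add (hf.mul (ha.mul hb))

/- The terms quadratic in `f` which contain `aᵢ²` and `aⱼ²` come from the derivatives of `f`; they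
complete the sum over `l ≠ i, j` to the full sum of squares. -/
theorem HasRotPd.pd_add_pd_sub_sum_add_mul_mul {g g' : Fin n → Fin n → Coord n → ℝ}
    {f : Coord n → ℝ} {a b : Fin n → Coord n → ℝ} {α β : Fin n → ℝ}
    (hg : ∀ k i j, HasPd k (g i j) (pd k (g i j) x) x)
    (hf : ∀ k, HasPd k f (-(f x ^ 2 * (a k x * b k x))) x)
    (ha : ∀ j, HasRotPd (fun i => g i j x) j a (α j) x)
    (hb : ∀ j, HasRotPd (fun i => g j i x) j b (β j) x)
    (hg' : ∀ i j, i ≠ j → g' i j = fun y => g i j y + f y * (a i y * b j y)) (hij : i ≠ j) :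
    pd i (g' i j) x + pd j (g' j i) x
        - ∑ l ∈ (Finset.univ.erase i).erase j, g' l i x * g' l j x
      = pd i (g i j) x + pd j (g j i) x
        - (∑ l ∈ (Finset.univ.erase i).erase j, g l i x * g l j x)
        + f x * (α i * b j x + α j * b i x) - f x ^ 2 * b i x * b j x * ∑ l, a l x ^ 2 := by
  have hsum : ∑ l ∈ (Finset.univ.erase i).erase j, g' l i x * g' l j x
      = (∑ l ∈ (Finset.univ.erase i).erase j, g l i x * g l j x)
        + f x * b j x * (∑ l ∈ (Finset.univ.erase i).erase j, g l i x • a l x)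
        + f x * b i x * (∑ l ∈ (Finset.univ.erase i).erase j, g l j x • a l x)
        + f x ^ 2 * b i x * b j x * (∑ l ∈ (Finset.univ.erase i).erase j, a l x ^ 2) := by
    simp only [Finset.mul_sum, ← Finset.sum_add_distrib]
    refine Finset.sum_congr rfl fun l hl => ?_
    obtain ⟨hlj, hli⟩ := Finset.mem_erase.1 hl
    rw [hg' l i (Finset.ne_of_mem_erase hli), hg' l j hlj, smul_eq_mul, smul_eq_mul]
    ring
  rw [hsum, hg' i j hij, hg' j i hij.symm,
    ((hg i i j).add_mul_mul (hf i) (ha i).diag ((hb i).offdiag j hij.symm)).pd_eq,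
    ((hg j j i).add_mul_mul (hf j) (ha j).diag ((hb j).offdiag i hij)).pd_eq,
    sum_erase_eq_add_left hij, sum_erase_eq_add_right hij,
    sum_erase_erase_eq_sub_sub hij fun l => a l x ^ 2]
  simp only [smul_eq_mul]
  ring

theorem gammaT_self (i : Fin n) (x : Coord n) : gammaT μ ξ η γ i i x = 0 := if_pos rfl

theorem gammaT_of_ne (h : i ≠ j) :
    gammaT μ ξ η γ i j = fun y => γ i j y + 2 * μ / Del ξ y * (ξ i y * η j y) := by
  ext y
  rw [gammaT, if_neg h]
  ring

theorem rhoT_eq (i : Fin n) :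
    rhoT μ ξ ζ ρ i = fun y => ρ i y - 2 * μ / Del ξ y * (ζ y * ξ i y) := by
  ext y
  rw [rhoT]
  ring

theorem smoothOn_rhoT (hG : GaussCodazzi K U ρ γ) (hD : IsDarbouxData K U ρ γ μ ξ η ζ)
    (i : Fin n) : SmoothOn (rhoT μ ξ ζ ρ i) U :=
  (hG.smooth_rho i).sub (((contDiffOn_const.mul hD.smoothOn_zeta).mul
    (hD.smoothOn_xi i)).div hD.smoothOn_del hD.del_ne_zero)

theorem smoothOn_gammaT (hG : GaussCodazzi K U ρ γ) (hD : IsDarbouxData K U ρ γ μ ξ η ζ)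
    (i j : Fin n) : SmoothOn (gammaT μ ξ η γ i j) U := by
  rcases eq_or_ne i j with rfl | hij
  · exact (contDiffOn_const (c := (0 : ℝ))).congr fun x _ => gammaT_self i x
  · rw [gammaT_of_ne hij]
    exact (hG.smooth_gamma i j).add ((contDiffOn_const.div hD.smoothOn_del hD.del_ne_zero).mul
      ((hD.smoothOn_xi i).mul (hD.smoothOn_eta j)))

theorem pd_gammaT_add_pd_gammaT (hU : IsOpen U) (hG : GaussCodazzi K U ρ γ)
    (hD : IsDarbouxData K U ρ γ μ ξ η ζ) (hx : x ∈ U) (hij : i ≠ j) :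
    pd i (gammaT μ ξ η γ i j) x + pd j (gammaT μ ξ η γ j i) x
      = ∑ l ∈ (Finset.univ.erase i).erase j, gammaT μ ξ η γ l i x * gammaT μ ξ η γ l j x := by
  have hdiff := HasRotPd.pd_add_pd_sub_sum_add_mul_mul (g' := gammaT μ ξ η γ)
    (f := fun y => 2 * μ / Del ξ y)
    (fun k i j => SmoothOn.hasPd (hG.smooth_gamma i j) hU hx k)
    (fun k => (hD.hasPd_div_del hU hx k (2 * μ)).congr_deriv (by ring))
    (hD.hasRotPd_xi hU hx) (hD.hasRotPd_eta hU hx) (fun i j => gammaT_of_ne) hij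
  have hold := hG.eq₁ x hx i j hij
  have hΔ : 2 * μ / Del ξ x * ∑ l, ξ l x ^ 2 = 2 * μ := div_mul_cancel₀ _ (hD.del_ne_zero x hx)
  linear_combination hdiff + hold - 2 * μ / Del ξ x * η i x * η j x * hΔ

theorem pd_gammaT_add_gammaT_mul_gammaT (hU : IsOpen U) (hG : GaussCodazzi K U ρ γ)
    (hD : IsDarbouxData K U ρ γ μ ξ η ζ) (hx : x ∈ U) {k : Fin n} (hij : i ≠ j) (hik : i ≠ k)
    (hjk : j ≠ k) :
    pd k (gammaT μ ξ η γ i j) x + gammaT μ ξ η γ i k x * gammaT μ ξ η γ k j x = 0 := by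
  rw [gammaT_of_ne hij, gammaT_of_ne hik, gammaT_of_ne hjk.symm,
    (HasPd.add_mul_mul (SmoothOn.hasPd (hG.smooth_gamma i j) hU hx k)
      (hD.hasPd_div_del hU hx k (2 * μ)) ((hD.hasRotPd_xi hU hx k).offdiag i hik)
      ((hD.hasRotPd_eta hU hx k).offdiag j hjk)).pd_eq]
  simp only [smul_eq_mul]
  linear_combination hG.eq₂ x hx i j k hij hik hjk

theorem pd_gammaT_transpose_add_pd_gammaT_transpose (hU : IsOpen U) (hG : GaussCodazzi K U ρ γ)
    (hD : IsDarbouxData K U ρ γ μ ξ η ζ) (hx : x ∈ U) (hij : i ≠ j) :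
    pd i (gammaT μ ξ η γ j i) x + pd j (gammaT μ ξ η γ i j) x
        - (∑ l ∈ (Finset.univ.erase i).erase j, gammaT μ ξ η γ i l x * gammaT μ ξ η γ j l x)
        - K * rhoT μ ξ ζ ρ i x * rhoT μ ξ ζ ρ j x = 0 := by
  have hdiff := HasRotPd.pd_add_pd_sub_sum_add_mul_mul (g := fun i j => γ j i)
    (g' := fun i j => gammaT μ ξ η γ j i) (f := fun y => 2 * μ / Del ξ y)
    (fun k i j => SmoothOn.hasPd (hG.smooth_gamma j i) hU hx k)
    (fun k => (hD.hasPd_div_del hU hx k (2 * μ)).congr_deriv (by ring))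
    (hD.hasRotPd_eta hU hx) (hD.hasRotPd_xi hU hx)
    (fun i j hij => (gammaT_of_ne hij.symm).trans (by simp only [mul_comm (ξ j _)])) hij
  have hold := hG.eq₃ x hx i j hij
  have hΔ : 2 * μ / Del ξ x * ∑ l, ξ l x ^ 2 = 2 * μ := div_mul_cancel₀ _ (hD.del_ne_zero x hx)
  rw [rhoT_eq, rhoT_eq]
  linear_combination hdiff + hold - 2 * μ / Del ξ x * ξ i x * ξ j x * hΔ
    + (2 * μ / Del ξ x) ^ 2 * ξ i x * ξ j x * hD.quadric x hx

theorem pd_rhoT_add_gammaT_mul_rhoT (hU : IsOpen U) (hG : GaussCodazzi K U ρ γ)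
    (hD : IsDarbouxData K U ρ γ μ ξ η ζ) (hx : x ∈ U) (hij : i ≠ j) :
    pd j (rhoT μ ξ ζ ρ i) x + gammaT μ ξ η γ i j x * rhoT μ ξ ζ ρ j x = 0 := by
  rw [rhoT_eq, rhoT_eq, gammaT_of_ne hij, ((SmoothOn.hasPd (hG.smooth_rho i) hU hx j).sub
    ((hD.hasPd_div_del hU hx j (2 * μ)).mul
      ((hD.hasPd_zeta hU hx j).mul ((hD.hasRotPd_xi hU hx j).offdiag i hij)))).pd_eq]
  simp only [smul_eq_mul]
  linear_combination hG.eq₄ x hx i j hij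

theorem GaussCodazzi.darboux (hU : IsOpen U) (hG : GaussCodazzi K U ρ γ)
    (hD : IsDarbouxData K U ρ γ μ ξ η ζ) :
    GaussCodazzi K U (rhoT μ ξ ζ ρ) (gammaT μ ξ η γ) where
  smooth_rho := smoothOn_rhoT hG hD
  smooth_gamma := smoothOn_gammaT hG hD
  diag x _ i := gammaT_self i x
  eq₁ _ hx _ _ hij := pd_gammaT_add_pd_gammaT hU hG hD hx hij
  eq₂ _ hx _ _ _ hij hik hjk := pd_gammaT_add_gammaT_mul_gammaT hU hG hD hx hij hik hjk
  eq₃ _ hx _ _ hij := pd_gammaT_transpose_add_pd_gammaT_transpose hU hG hD hx hij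
  eq₄ _ hx _ _ hij := pd_rhoT_add_gammaT_mul_rhoT hU hG hD hx hij

end GaussCodazzi

section Omega

theorem one_sub_smul_vecMulVec_mem_orthogonalGroup {ι R : Type*} [Fintype ι] [DecidableEq ι]
    [Field R] {v : ι → R} (h : v ⬝ᵥ v ≠ 0) :
    1 - (2 / (v ⬝ᵥ v)) • Matrix.vecMulVec v v ∈ Matrix.orthogonalGroup ι R := by
  rw [Matrix.mem_orthogonalGroup_iff, Matrix.transpose_sub, Matrix.transpose_one,
    Matrix.transpose_smul, Matrix.transpose_vecMulVec, sub_mul, mul_sub, mul_sub,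
    smul_mul_smul_comm, Matrix.vecMulVec_mul_vecMulVec, one_mul, mul_one, one_mul,
    Matrix.vecMulVec_smul, smul_smul]
  have hc : 2 / (v ⬝ᵥ v) * (2 / (v ⬝ᵥ v)) * (v ⬝ᵥ v) = 2 / (v ⬝ᵥ v) + 2 / (v ⬝ᵥ v) := by
    field_simp
    norm_num
  rw [hc, add_smul]
  abel

variable {n : ℕ} {K : ℝ} {U : Set (Coord n)} {ρ : Fin n → Coord n → ℝ}
  {γ : Fin n → Fin n → Coord n → ℝ} {μ : ℝ} {ξ η : Fin n → Coord n → ℝ} {ζ : Coord n → ℝ}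
  {ω : Coord n → Matrix (Fin n) (Fin n) ℝ}

theorem omegaT_eq_mul (ω : Coord n → Matrix (Fin n) (Fin n) ℝ) (x : Coord n) :
    omegaT ξ ω x =
      (1 - (2 / Del ξ x) • Matrix.vecMulVec (fun i => ξ i x) (fun i => ξ i x)) * ω x := by
  ext i α
  rw [sub_mul, one_mul, smul_mul_assoc]
  simp only [omegaT, Matrix.of_apply, Matrix.sub_apply, Matrix.smul_apply, Matrix.mul_apply,
    Matrix.vecMulVec_apply, smul_eq_mul, Finset.mul_sum]
  congr 1
  exact Finset.sum_congr rfl fun j _ => by ring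

theorem omegaT_apply (ω : Coord n → Matrix (Fin n) (Fin n) ℝ) (x : Coord n) (i α : Fin n) :
    omegaT ξ ω x i α = ω x i α - (2 / Del ξ x * ξ i x) • ∑ j, ξ j x • ω x j α := by
  simp only [omegaT, Matrix.of_apply, smul_eq_mul, Finset.mul_sum]
  congr 1
  exact Finset.sum_congr rfl fun j _ => by ring

theorem OmegaSystem.darboux (hU : IsOpen U) (hD : IsDarbouxData K U ρ γ μ ξ η ζ)
    (hω : OmegaSystem U γ ω) : OmegaSystem U (gammaT μ ξ η γ) (omegaT ξ ω) := by
  refine .of_hasRotPd (fun i α => ?_) (fun x hx => ?_) fun x hx j α => ?_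
  · exact (hω.smooth i α).sub (ContDiffOn.sum fun j _ => (((contDiffOn_const.mul
      (hD.smoothOn_xi i)).mul (hD.smoothOn_xi j)).div hD.smoothOn_del hD.del_ne_zero).mul
        (hω.smooth j α))
  · have hdot : (fun i => ξ i x) ⬝ᵥ (fun i => ξ i x) = Del ξ x := by simp only [dotProduct, Del, sq]
    rw [omegaT_eq_mul, ← hdot]
    exact mul_mem (one_sub_smul_vecMulVec_mem_orthogonalGroup (hdot ▸ hD.del_ne_zero x hx))
      (hω.orthogonal x hx)
  · have h0 := hD.del_ne_zero x hx
    have hcol := hω.hasRotPd hU hx j α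
    have hξ := hD.hasRotPd_xi hU hx j
    have hT := (hcol.sub_smul_smul (t := 2 * μ / Del ξ x * η j x) hξ
      ((hD.hasPd_div_del hU hx j 2).congr_deriv (by ring)) (hξ.sum_smul hcol)
      (by simp only [smul_eq_mul]; ring)).congr_coeff (c' := fun i => gammaT μ ξ η γ i j x)
      fun i hij => by rw [gammaT_of_ne hij]; ring
    simp only [omegaT_apply]
    convert hT using 1
    rw [← Del]
    simp only [smul_eq_mul]
    field_simp
    ring

end Omega

section OrthogonalFamilies

variable {E ι : Type*} [AddCommGroup E] [Module ℝ E] {B : E →ₗ[ℝ] E →ₗ[ℝ] ℝ} {v : ι → E}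

theorem eq_zero_of_isOrthoᵢ [Fintype ι] [FiniteDimensional ℝ E] [Nonempty ι] (hv : B.IsOrthoᵢ v)
    (hv' : ∀ a, B (v a) (v a) ≠ 0) (hcard : Fintype.card ι = Module.finrank ℝ E) {X : E}
    (hX : ∀ a, B (v a) X = 0) : X = 0 := by
  let b := basisOfLinearIndependentOfCardEqFinrank
    (LinearMap.linearIndependent_of_isOrthoᵢ hv hv') hcard
  have hb : ⇑b = v := coe_basisOfLinearIndependentOfCardEqFinrank _ _
  rw [← hb] at hv hv'
  refine LinearMap.IsOrthoᵢ.separatingRight_iff_not_isOrtho_basis_self b hv hv' X fun Y => ?_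
  rw [← b.sum_repr Y, hb]
  simp [hX]

theorem linearIndependent_of_orthonormal [DecidableEq ι]
    (h : ∀ a b, B (v a) (v b) = if a = b then 1 else 0) :
    LinearIndependent ℝ v :=
  LinearMap.linearIndependent_of_isOrthoᵢ (B := B) (fun a b hab => (h a b).trans (if_neg hab))
    fun a ha => one_ne_zero ((if_pos rfl).symm.trans ((h a a).symm.trans ha))

theorem orthonormal_of_mem_orthogonalGroup [Fintype ι] [DecidableEq ι]
    (h : ∀ a b, B (v a) (v b) = if a = b then 1 else 0) {A : Matrix ι ι ℝ}
    (hA : A ∈ Matrix.orthogonalGroup ι ℝ) (a b : ι) :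
    B (∑ c, A a c • v c) (∑ c, A b c • v c) = if a = b then 1 else 0 := by
  rw [← Matrix.one_apply, ← (Matrix.mem_orthogonalGroup_iff ι ℝ).1 hA, Matrix.mul_apply]
  simp [h, mul_comm]

end OrthogonalFamilies

section PlaneRotation

variable {E : Type*} [AddCommGroup E] [Module ℝ E]

/-- The rotation by the angle `-2 arctan μ` in the plane spanned by two orthogonal vectors `P` and
`Q` of square length `D`, written with the scalar `d` for which `d (1 + μ²) D = 2 μ`. -/
def planeRotation (B : E →ₗ[ℝ] E →ₗ[ℝ] ℝ) (d μ : ℝ) (P Q X : E) : E :=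
  X - (d * B P X) • (μ • P + Q) + (d * B Q X) • (P - μ • Q)

theorem planeRotation_isometry {B : E →ₗ[ℝ] E →ₗ[ℝ] ℝ} (hB : ∀ X Y, B X Y = B Y X)
    {d μ D : ℝ} {P Q : E} (hPP : B P P = D) (hQQ : B Q Q = D) (hPQ : B P Q = 0)
    (hd : d * (1 + μ ^ 2) * D = 2 * μ) (X Y : E) :
    B (planeRotation B d μ P Q X) (planeRotation B d μ P Q Y) = B X Y := by
  simp only [planeRotation, map_add, map_sub, map_smul, LinearMap.add_apply, LinearMap.sub_apply,
    LinearMap.smul_apply, smul_eq_mul, hPP, hQQ, hPQ, hB Q P, hB X P, hB X Q]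
  linear_combination d * (B P X * B P Y + B Q X * B Q Y) * hd

end PlaneRotation

section AdaptedFrames

variable {n : ℕ} {K : ℝ}

/-- The tangent space `spaceFormTangent K y` of `M_{2n}(K)` at `y`, bundled as a subspace. -/
def tangentSubmodule (K : ℝ) (y : Ambient n) : Submodule ℝ (Ambient n) where
  carrier := spaceFormTangent K y
  add_mem' ha hb := ⟨fun h => by simp only [Pi.add_apply, ha.1 h, hb.1 h, add_zero], fun h => by
    rw [← ambientForm_apply, map_add, ambientForm_apply, ambientForm_apply, ha.2 h, hb.2 h,
      add_zero]⟩
  zero_mem' := ⟨fun _ => rfl, fun _ => by rw [← ambientForm_apply, map_zero]⟩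
  smul_mem' c a ha := ⟨fun h => by simp only [Pi.smul_apply, ha.1 h, smul_zero], fun h => by
    rw [← ambientForm_apply, map_smul, ambientForm_apply, ha.2 h, smul_zero]⟩

theorem mul_ambientForm_of_mem_tangent {y X : Ambient n} (h : X ∈ spaceFormTangent K y) :
    K * ambientForm K y X = 0 := by
  by_cases h0 : K = 0
  · rw [h0, zero_mul]
  · rw [ambientForm_apply, h.2 h0, mul_zero]

theorem mul_ambientForm_self_of_mem {y : Ambient n} (h : y ∈ spaceForm n K) :
    K * ambientForm K y y = K * K := by
  by_cases h0 : K = 0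
  · rw [h0, zero_mul, zero_mul]
  · rw [ambientForm_apply, h.2 h0]

theorem exists_mem_spaceFormTangent_iff {y : Ambient n} (hy : y ∈ spaceForm n K) :
    ∃ z, ambientForm K z z ≠ 0 ∧ ∀ X, X ∈ spaceFormTangent K y ↔ ambientForm K z X = 0 := by
  by_cases h0 : K = 0
  · have hz (X : Ambient n) :
        ambientForm K (Pi.single (Fin.last (2 * n)) 1) X = X (Fin.last (2 * n)) := by
      simp [ambientForm_apply, ambientInner, h0, (Fin.castSucc_lt_last _).ne]
    exact ⟨Pi.single (Fin.last (2 * n)) 1, by simp [hz], fun X => by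
      rw [hz]; simp [spaceFormTangent, h0]⟩
  · exact ⟨y, by rwa [ambientForm_apply, hy.2 h0], fun X => by
      simp [spaceFormTangent, h0, ambientForm_apply]⟩

/-- `r` lies on `M_{2n}(K)`, and `p₁, …, pₙ, q₁, …, qₙ` is an orthonormal basis of the tangent
space at `r`: the pointwise part of `IsMovingFrame`. -/
structure IsAdaptedFrame (K : ℝ) (p q : Fin n → Ambient n) (r : Ambient n) : Prop where
  mem : r ∈ spaceForm n K
  p_tangent : ∀ i, p i ∈ spaceFormTangent K r
  q_tangent : ∀ i, q i ∈ spaceFormTangent K r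
  inner_pp : ∀ i j, ambientForm K (p i) (p j) = if i = j then 1 else 0
  inner_qq : ∀ i j, ambientForm K (q i) (q j) = if i = j then 1 else 0
  inner_pq : ∀ i j, ambientForm K (p i) (q j) = 0

namespace IsMovingFrame

variable {U : Set (Coord n)} {ρ : Fin n → Coord n → ℝ} {γ : Fin n → Fin n → Coord n → ℝ}
  {p q : Fin n → Coord n → Ambient n} {r : Coord n → Ambient n}

theorem isAdaptedFrame (h : IsMovingFrame K U ρ γ p q r) {x : Coord n} (hx : x ∈ U) :
    IsAdaptedFrame K (p · x) (q · x) (r x) :=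
  ⟨h.mem x hx, h.p_tangent x hx, h.q_tangent x hx, h.inner_pp x hx, h.inner_qq x hx,
    h.inner_pq x hx⟩

theorem of_isAdaptedFrame (hL : LaxSystem K U ρ γ (1 : ℝ) p q r)
    (h : ∀ x ∈ U, IsAdaptedFrame K (p · x) (q · x) (r x)) : IsMovingFrame K U ρ γ p q r :=
  ⟨hL, fun x hx => (h x hx).mem, fun x hx => (h x hx).p_tangent, fun x hx => (h x hx).q_tangent,
    fun x hx => (h x hx).inner_pp, fun x hx => (h x hx).inner_qq, fun x hx => (h x hx).inner_pq⟩

end IsMovingFrame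

/-- The vector `∑ ξⱼ pⱼ`, the first axis of the rotation of an adapted frame. -/
def pAxis (ξ : Fin n → ℝ) (p : Fin n → Ambient n) : Ambient n :=
  ∑ j, ξ j • p j

/-- The vector `∑ ηⱼ qⱼ + K ζ r`, the second axis of the rotation of an adapted frame. -/
def qAxis (K : ℝ) (η : Fin n → ℝ) (ζ : ℝ) (q : Fin n → Ambient n) (r : Ambient n) : Ambient n :=
  (∑ j, η j • q j) + (K * ζ) • r

namespace IsAdaptedFrame

variable {p q : Fin n → Ambient n} {r X Y : Ambient n} {ξ η : Fin n → ℝ} {ζ : ℝ}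

theorem inner_qp (h : IsAdaptedFrame K p q r) (i j : Fin n) : ambientForm K (q i) (p j) = 0 :=
  (ambientForm_comm _ _).trans (h.inner_pq j i)

theorem ext (h : IsAdaptedFrame K p q r) (hX : X ∈ spaceFormTangent K r)
    (hY : Y ∈ spaceFormTangent K r)
    (hp : ∀ i, ambientForm K (p i) X = ambientForm K (p i) Y)
    (hq : ∀ i, ambientForm K (q i) X = ambientForm K (q i) Y) : X = Y := by
  obtain ⟨z, hzz, hz⟩ := exists_mem_spaceFormTangent_iff h.mem
  have hzp i := (hz _).1 (h.p_tangent i)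
  have hzq i := (hz _).1 (h.q_tangent i)
  rw [← sub_eq_zero]
  refine eq_zero_of_isOrthoᵢ (B := ambientForm K) (v := column p q z)
    (LinearMap.isOrthoᵢ_def.2 ?_) ?_ (by simp; ring) ?_
  · rintro (a | a | a) (b | b | b) hab <;>
      simp_all [column, h.inner_pp, h.inner_qq, h.inner_pq, h.inner_qp, ambientForm_comm _ z]
  · rintro (a | a | _) <;> simp [column, h.inner_pp, h.inner_qq, hzz]
  · rintro (a | a | a) <;> simp [column, hp, hq, (hz _).1 hX, (hz _).1 hY]

theorem mul_orthogonal (h : IsAdaptedFrame K p q r) {A : Matrix (Fin n) (Fin n) ℝ}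
    (hA : A ∈ Matrix.orthogonalGroup (Fin n) ℝ) :
    IsAdaptedFrame K (fun i => ∑ j, A i j • p j) q r where
  mem := h.mem
  p_tangent i := (tangentSubmodule K r).sum_mem fun j _ =>
    (tangentSubmodule K r).smul_mem _ (h.p_tangent j)
  q_tangent := h.q_tangent
  inner_pp := orthonormal_of_mem_orthogonalGroup h.inner_pp hA
  inner_qq := h.inner_qq
  inner_pq i j := by
    simp only [map_sum, map_smul, LinearMap.sum_apply, LinearMap.smul_apply, h.inner_pq, smul_zero,
      Finset.sum_const_zero]

theorem map_isometry (h : IsAdaptedFrame K p q r) {T : Ambient n → Ambient n}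
    (hT : ∀ X Y, ambientForm K (T X) (T Y) = ambientForm K X Y) {s : Ambient n}
    (hs : K ≠ 0 → s = T r) (hs₀ : K = 0 → s (Fin.last (2 * n)) = 0)
    (hT₀ : K = 0 → ∀ X, X (Fin.last (2 * n)) = 0 → T X (Fin.last (2 * n)) = 0) :
    IsAdaptedFrame K (fun i => T (p i)) (fun i => T (q i)) s := by
  have htangent {X : Ambient n} (hX : X ∈ spaceFormTangent K r) : T X ∈ spaceFormTangent K s :=
    ⟨fun h0 => hT₀ h0 X (hX.1 h0), fun h0 => by rw [hs h0]; exact (hT _ _).trans (hX.2 h0)⟩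
  exact ⟨⟨hs₀, fun h0 => by rw [hs h0]; exact (hT _ _).trans (h.mem.2 h0)⟩,
    fun i => htangent (h.p_tangent i), fun i => htangent (h.q_tangent i),
    fun i j => (hT _ _).trans (h.inner_pp i j), fun i j => (hT _ _).trans (h.inner_qq i j),
    fun i j => (hT _ _).trans (h.inner_pq i j)⟩

theorem inner_pAxis_p (h : IsAdaptedFrame K p q r) (i : Fin n) :
    ambientForm K (pAxis ξ p) (p i) = ξ i := by
  simp [pAxis, h.inner_pp]

theorem inner_pAxis_q (h : IsAdaptedFrame K p q r) (i : Fin n) :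
    ambientForm K (pAxis ξ p) (q i) = 0 := by
  simp [pAxis, h.inner_pq]

theorem pAxis_tangent (h : IsAdaptedFrame K p q r) : pAxis ξ p ∈ spaceFormTangent K r :=
  (tangentSubmodule K r).sum_mem fun j _ => (tangentSubmodule K r).smul_mem _ (h.p_tangent j)

theorem inner_qAxis_p (h : IsAdaptedFrame K p q r) (i : Fin n) :
    ambientForm K (qAxis K η ζ q r) (p i) = 0 := by
  have hr := mul_ambientForm_of_mem_tangent (h.p_tangent i)
  simp [qAxis, h.inner_qp, mul_right_comm K ζ, hr]

theorem inner_qAxis_q (h : IsAdaptedFrame K p q r) (i : Fin n) :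
    ambientForm K (qAxis K η ζ q r) (q i) = η i := by
  have hr := mul_ambientForm_of_mem_tangent (h.q_tangent i)
  simp [qAxis, h.inner_qq, mul_right_comm K ζ, hr]

theorem mul_inner_qAxis_point (h : IsAdaptedFrame K p q r) (hK : K * K * K = K) :
    K * ambientForm K (qAxis K η ζ q r) r = K * ζ := by
  have hq (i : Fin n) : K * ambientForm K (q i) r = 0 := by
    rw [ambientForm_comm, mul_ambientForm_of_mem_tangent (h.q_tangent i)]
  have hr := mul_ambientForm_self_of_mem h.mem
  simp only [qAxis, map_add, map_sum, map_smul, LinearMap.add_apply, LinearMap.sum_apply,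
    LinearMap.smul_apply, smul_eq_mul, mul_add, Finset.mul_sum, mul_left_comm K (η _), hq, mul_zero,
    Finset.sum_const_zero, zero_add]
  linear_combination K * ζ * hr + ζ * hK

theorem inner_pAxis_pAxis (h : IsAdaptedFrame K p q r) :
    ambientForm K (pAxis ξ p) (pAxis ξ p) = ∑ i, ξ i ^ 2 := by
  conv_lhs => rw [pAxis.eq_def ξ p, map_sum, ← pAxis]
  simp only [map_smul, h.inner_pAxis_p, smul_eq_mul, sq]

theorem inner_pAxis_qAxis (h : IsAdaptedFrame K p q r) :
    ambientForm K (pAxis ξ p) (qAxis K η ζ q r) = 0 := by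
  rw [ambientForm_comm, pAxis, map_sum]
  simp only [map_smul, h.inner_qAxis_p, smul_zero, Finset.sum_const_zero]

theorem inner_qAxis_qAxis (h : IsAdaptedFrame K p q r) (hK : K * K * K = K) :
    ambientForm K (qAxis K η ζ q r) (qAxis K η ζ q r) = (∑ i, η i ^ 2) + K * ζ ^ 2 := by
  have hr := h.mul_inner_qAxis_point (η := η) (ζ := ζ) hK
  have hsum : ambientForm K (qAxis K η ζ q r) (∑ i, η i • q i) = ∑ i, η i ^ 2 := by
    simp only [map_sum, map_smul, h.inner_qAxis_q, smul_eq_mul, sq]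
  conv_lhs => enter [2]; rw [qAxis]
  rw [map_add, hsum, map_smul, smul_eq_mul]
  linear_combination ζ * hr

theorem darboux (h : IsAdaptedFrame K p q r) (hK : K * K * K = K) {μ d D : ℝ}
    (hξ : ∑ i, ξ i ^ 2 = D) (hη : (∑ i, η i ^ 2) + K * ζ ^ 2 = D)
    (hd : d * (1 + μ ^ 2) * D = 2 * μ) :
    IsAdaptedFrame K (fun i => p i - (d * ξ i) • (μ • pAxis ξ p + qAxis K η ζ q r))
      (fun i => q i + (d * η i) • (pAxis ξ p - μ • qAxis K η ζ q r))
      (r + (d * ζ) • (pAxis ξ p - μ • qAxis K η ζ q r)) := by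
  have hT := planeRotation_isometry ambientForm_comm (h.inner_pAxis_pAxis.trans hξ)
    ((h.inner_qAxis_qAxis hK).trans hη) h.inner_pAxis_qAxis hd
  have hlast (h0 : K = 0) : pAxis ξ p (Fin.last (2 * n)) = 0 ∧
      qAxis K η ζ q r (Fin.last (2 * n)) = 0 :=
    ⟨h.pAxis_tangent.1 h0, by simp [qAxis, (h.q_tangent _).1 h0, h0]⟩
  have hpoint (h0 : K ≠ 0) : r + (d * ζ) • (pAxis ξ p - μ • qAxis K η ζ q r)
      = planeRotation (ambientForm K) d μ (pAxis ξ p) (qAxis K η ζ q r) r := by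
    rw [planeRotation, mul_left_cancel₀ h0 (h.mul_inner_qAxis_point hK), ambientForm_comm _ r,
      ambientForm_apply r, h.pAxis_tangent.2 h0, mul_zero, zero_smul, sub_zero]
  convert h.map_isometry hT hpoint (fun h0 => ?_) (fun h0 X hX => ?_) using 2 with i i
  · simp [planeRotation, h.inner_pAxis_p, h.inner_qAxis_p]
  · simp [planeRotation, h.inner_pAxis_q, h.inner_qAxis_q]
  · simp [(hlast h0).1, (hlast h0).2, h.mem.1 h0]
  · simp [planeRotation, (hlast h0).1, (hlast h0).2, hX]

end IsAdaptedFrame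

end AdaptedFrames

section FrameTransform

variable {n : ℕ} {K : ℝ} {U : Set (Coord n)} {ρ : Fin n → Coord n → ℝ}
  {γ : Fin n → Fin n → Coord n → ℝ} {μ : ℝ} {ξ η : Fin n → Coord n → ℝ} {ζ : Coord n → ℝ}
  {p q : Fin n → Coord n → Ambient n} {r : Coord n → Ambient n} {x : Coord n}

theorem pT_eq (i : Fin n) (x : Coord n) : pT K μ ξ η ζ p q r i x =
    p i x - (bCoeff μ / Del ξ x * ξ i x) •
      (μ • pAxis (ξ · x) (p · x) + qAxis K (η · x) (ζ x) (q · x) (r x)) := by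
  have hp (j : Fin n) : bCoeff μ * μ * ξ i x * ξ j x / Del ξ x
      = bCoeff μ / Del ξ x * ξ i x * (μ * ξ j x) := by ring
  have hq (j : Fin n) : bCoeff μ * ξ i x * η j x / Del ξ x
      = bCoeff μ / Del ξ x * ξ i x * η j x := by ring
  have hr : K * bCoeff μ * ζ x * ξ i x / Del ξ x
      = bCoeff μ / Del ξ x * ξ i x * (K * ζ x) := by ring
  simp only [pT, pAxis, qAxis, smul_add, Finset.smul_sum, smul_smul, hp, hq, hr]
  abel

theorem qT_eq (i : Fin n) (x : Coord n) : qT K μ ξ η ζ p q r i x =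
    q i x + (bCoeff μ / Del ξ x * η i x) •
      (pAxis (ξ · x) (p · x) - μ • qAxis K (η · x) (ζ x) (q · x) (r x)) := by
  have hp (j : Fin n) : bCoeff μ * η i x * ξ j x / Del ξ x
      = bCoeff μ / Del ξ x * η i x * ξ j x := by ring
  have hq (j : Fin n) : bCoeff μ * μ * η i x * η j x / Del ξ x
      = bCoeff μ / Del ξ x * η i x * (μ * η j x) := by ring
  have hr : K * bCoeff μ * μ * ζ x * η i x / Del ξ x
      = bCoeff μ / Del ξ x * η i x * (μ * (K * ζ x)) := by ring
  simp only [qT, pAxis, qAxis, smul_add, smul_sub, Finset.smul_sum, smul_smul, hp, hq, hr]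
  abel

theorem rT_eq (x : Coord n) : rT K μ ξ η ζ p q r x =
    r x + (bCoeff μ / Del ξ x * ζ x) •
      (pAxis (ξ · x) (p · x) - μ • qAxis K (η · x) (ζ x) (q · x) (r x)) := by
  have hp (j : Fin n) : bCoeff μ * ζ x * ξ j x / Del ξ x
      = bCoeff μ / Del ξ x * ζ x * ξ j x := by ring
  have hq (j : Fin n) : bCoeff μ * μ * ζ x * η j x / Del ξ x
      = bCoeff μ / Del ξ x * ζ x * (μ * η j x) := by ring
  have hr : K * bCoeff μ * μ * ζ x ^ 2 / Del ξ x
      = bCoeff μ / Del ξ x * ζ x * (μ * (K * ζ x)) := by ring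
  simp only [rT, pAxis, qAxis, smul_add, smul_sub, Finset.smul_sum, smul_smul, hp, hq, hr]
  abel

theorem bCoeff_div_mul (μ D : ℝ) : bCoeff μ / D * (1 + μ ^ 2) = 2 * μ / D := by
  have : 1 + μ ^ 2 ≠ 0 := by positivity
  rw [bCoeff]
  field_simp

variable (hU : IsOpen U) (hD : IsDarbouxData K U ρ γ μ ξ η ζ)
  (hL : LaxSystem K U ρ γ (1 : ℝ) p q r)

include hD hL

theorem smoothOn_pAxis : SmoothOn (fun y => pAxis (ξ · y) (p · y)) U :=
  ContDiffOn.sum fun j _ => (hD.smoothOn_xi j).smul (hL.smooth_u j)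

theorem smoothOn_qAxis : SmoothOn (fun y => qAxis K (η · y) (ζ y) (q · y) (r y)) U :=
  (ContDiffOn.sum fun j _ => (hD.smoothOn_eta j).smul (hL.smooth_v j)).add
    ((contDiffOn_const.mul hD.smoothOn_zeta).smul hL.smooth_w)

theorem smoothOn_pT (i : Fin n) : SmoothOn (pT K μ ξ η ζ p q r i) U := by
  rw [funext (pT_eq i)]
  exact (hL.smooth_u i).sub (((contDiffOn_const.div hD.smoothOn_del hD.del_ne_zero).mul
    (hD.smoothOn_xi i)).smul
      (((contDiffOn_const (c := μ)).smul (smoothOn_pAxis hD hL)).add (smoothOn_qAxis hD hL)))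

theorem smoothOn_qT (i : Fin n) : SmoothOn (qT K μ ξ η ζ p q r i) U := by
  rw [funext (qT_eq i)]
  exact (hL.smooth_v i).add (((contDiffOn_const.div hD.smoothOn_del hD.del_ne_zero).mul
    (hD.smoothOn_eta i)).smul
      ((smoothOn_pAxis hD hL).sub ((contDiffOn_const (c := μ)).smul (smoothOn_qAxis hD hL))))

theorem smoothOn_rT : SmoothOn (rT K μ ξ η ζ p q r) U := by
  rw [funext rT_eq]
  exact hL.smooth_w.add (((contDiffOn_const.div hD.smoothOn_del hD.del_ne_zero).mul
    hD.smoothOn_zeta).smul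
      ((smoothOn_pAxis hD hL).sub ((contDiffOn_const (c := μ)).smul (smoothOn_qAxis hD hL))))

variable (hx : x ∈ U) (j : Fin n)

include hU hx

theorem hasPd_pAxis :
    HasPd j (fun y => pAxis (ξ · y) (p · y)) ((μ * η j x) • p j x - ξ j x • q j x) x :=
  ((hD.hasRotPd_xi hU hx j).sum_smul (hL.hasRotPd_u hU hx j)).congr_deriv (by module)

theorem hasPd_qAxis : HasPd j (fun y => qAxis K (η · y) (ζ y) (q · y) (r y))
    (η j x • p j x + (μ * ξ j x) • q j x) x :=
  (((hD.hasRotPd_eta hU hx j).sum_smul (hL.hasRotPd_v hU hx j)).add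
    (((HasPd.const j K x).mul (hD.hasPd_zeta hU hx j)).smul (hL.hasPd_w hU hx j))).congr_deriv
    (by module)

theorem hasRotPd_pT : HasRotPd (fun i => gammaT μ ξ η γ i j x) j (pT K μ ξ η ζ p q r)
    (-((1 : ℝ) • qT K μ ξ η ζ p q r j x)) x := by
  have hb := bCoeff_div_mul μ (Del ξ x)
  have hΔ : 2 * μ / Del ξ x * Del ξ x = 2 * μ := div_mul_cancel₀ _ (hD.del_ne_zero x hx)
  have hT := ((hL.hasRotPd_u hU hx j).sub_smul_smul (t := 2 * μ / Del ξ x * η j x)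
    (hD.hasRotPd_xi hU hx j) ((hD.hasPd_div_del hU hx j (bCoeff μ)).congr_deriv (by ring))
    (((HasPd.const j μ x).smul (hasPd_pAxis hU hD hL hx j)).add (hasPd_qAxis hU hD hL hx j))
    (by rw [← hb]; module)).congr_coeff (c' := fun i => gammaT μ ξ η γ i j x)
      fun i hij => by rw [gammaT_of_ne hij]; ring
  simp only [← pT_eq] at hT
  have hcoeff : bCoeff μ / Del ξ x * (2 * μ / Del ξ x * η j x) * Del ξ x
      = bCoeff μ / Del ξ x * η j x * (2 * μ) := by
    linear_combination bCoeff μ / Del ξ x * η j x * hΔ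
  convert hT using 1
  rw [qT_eq, ← Del, ← pAxis, hcoeff, ← hb]
  module

theorem hasRotPd_qT : HasRotPd (fun i => gammaT μ ξ η γ j i x) j (qT K μ ξ η ζ p q r)
    ((1 : ℝ) • pT K μ ξ η ζ p q r j x - (K * rhoT μ ξ ζ ρ j x) • rT K μ ξ η ζ p q r x) x := by
  have hb := bCoeff_div_mul μ (Del ξ x)
  have hΔ : 2 * μ / Del ξ x * Del ξ x = 2 * μ := div_mul_cancel₀ _ (hD.del_ne_zero x hx)
  have hT := ((hL.hasRotPd_v hU hx j).sub_smul_smul (t := 2 * μ / Del ξ x * ξ j x)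
    (hD.hasRotPd_eta hU hx j) ((hD.hasPd_div_del hU hx j (-bCoeff μ)).congr_deriv (by ring))
    ((hasPd_pAxis hU hD hL hx j).sub ((HasPd.const j μ x).smul (hasPd_qAxis hU hD hL hx j)))
    (by rw [neg_div, ← hb]; module)).congr_coeff (c' := fun i => gammaT μ ξ η γ j i x)
      fun i hij => by rw [gammaT_of_ne hij.symm]; ring
  simp only [neg_div, neg_mul, neg_smul, sub_neg_eq_add, ← qT_eq] at hT
  have hq : ∑ k, η k x • q k x = qAxis K (η · x) (ζ x) (q · x) (r x) - (K * ζ x) • r x :=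
    (add_sub_cancel_right _ _).symm
  have hη : ∑ k, η k x ^ 2 = Del ξ x - K * ζ x ^ 2 := eq_sub_of_add_eq (hD.quadric x hx).symm
  have hcoeff : bCoeff μ / Del ξ x * (2 * μ / Del ξ x * ξ j x) * (Del ξ x - K * ζ x ^ 2)
      = bCoeff μ / Del ξ x * ξ j x * (2 * μ)
        - bCoeff μ / Del ξ x * (2 * μ / Del ξ x) * ξ j x * K * ζ x ^ 2 := by
    linear_combination bCoeff μ / Del ξ x * ξ j x * hΔ
  convert hT using 1
  rw [pT_eq, rT_eq, congrFun (rhoT_eq j) x, hq, hη, hcoeff, ← hb]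
  module

theorem hasPd_rT : HasPd j (rT K μ ξ η ζ p q r)
    (rhoT μ ξ ζ ρ j x • qT K μ ξ η ζ p q r j x) x := by
  have hb := bCoeff_div_mul μ (Del ξ x)
  rw [funext (rT_eq (r := r))]
  refine ((hL.hasPd_w hU hx j).add (((hD.hasPd_div_del hU hx j (bCoeff μ)).mul
    (hD.hasPd_zeta hU hx j)).smul ((hasPd_pAxis hU hD hL hx j).sub
      ((HasPd.const j μ x).smul (hasPd_qAxis hU hD hL hx j))))).congr_deriv ?_
  rw [qT_eq, congrFun (rhoT_eq j) x, ← hb]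
  module

omit hx

theorem LaxSystem.darboux : LaxSystem K U (rhoT μ ξ ζ ρ) (gammaT μ ξ η γ) (1 : ℝ)
    (pT K μ ξ η ζ p q r) (qT K μ ξ η ζ p q r) (rT K μ ξ η ζ p q r) :=
  .of_hasRotPd (smoothOn_pT hD hL) (smoothOn_qT hD hL) (smoothOn_rT hD hL)
    (fun _ hx j => hasRotPd_pT hU hD hL hx j) (fun _ hx j => hasRotPd_qT hU hD hL hx j)
    fun _ hx j => hasPd_rT hU hD hL hx j

omit hL

theorem IsMovingFrame.darboux (hK : K * K * K = K) (hF : IsMovingFrame K U ρ γ p q r) :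
    IsMovingFrame K U (rhoT μ ξ ζ ρ) (gammaT μ ξ η γ)
      (pT K μ ξ η ζ p q r) (qT K μ ξ η ζ p q r) (rT K μ ξ η ζ p q r) := by
  refine .of_isAdaptedFrame (LaxSystem.darboux hU hD hF.structure_eq) fun x hx => ?_
  simp only [pT_eq, qT_eq, rT_eq]
  refine (hF.isAdaptedFrame hx).darboux hK rfl (hD.quadric x hx).symm ?_
  rw [bCoeff_div_mul]
  exact div_mul_cancel₀ _ (hD.del_ne_zero x hx)

end FrameTransform

theorem darbouxMatrix_diagonal_apply {ι : Type*} [Fintype ι] [DecidableEq ι] (s c : ι → ℂ) (μ : ℝ)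
    (H : ι → ℂ) (lam : ℂ) (a b : ι) :
    darbouxMatrix (.diagonal s) (.diagonal c) μ H lam a b = 1 / (lam ^ 2 + (μ : ℂ) ^ 2) *
      ((lam ^ 2 + (μ : ℂ) ^ 2) * (if a = b then 1 else 0)
        + 2 * μ / (star H ⬝ᵥ (Matrix.diagonal c).mulVec H) *
          (Complex.I * lam * (s a - s b) - μ * (s a + s b)) * (H a * star (H b) * s b * c b)) := by
  simp only [darbouxMatrix, Matrix.smul_apply, Matrix.add_apply, Matrix.sub_apply,
    Matrix.mul_diagonal, Matrix.diagonal_mul, Matrix.vecMulVec_apply, smul_eq_mul, Pi.star_apply,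
    Matrix.one_apply]
  ring

section DarbouxMatrix

variable {n : ℕ} {K : ℝ} {U : Set (Coord n)} {ρ : Fin n → Coord n → ℝ}
  {γ : Fin n → Fin n → Coord n → ℝ} {μ : ℝ} {ξ η : Fin n → Coord n → ℝ} {ζ : Coord n → ℝ}
  {x : Coord n}

theorem star_vecH_dotProduct :
    star (vecH ξ η ζ x) ⬝ᵥ (matC n K).mulVec (vecH ξ η ζ x) =
      ((∑ i, ξ i x ^ 2 + (∑ i, η i x ^ 2 + K * ζ x ^ 2) : ℝ) : ℂ) := by
  have hI (k : ℂ) (t : ℝ) : star (Complex.I * (t : ℂ)) * (k * (Complex.I * t)) = k * t ^ 2 := by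
    simp only [star_mul', Complex.star_def, Complex.conj_I, Complex.conj_ofReal]
    linear_combination -(k * (t : ℂ) ^ 2) * Complex.I_sq
  have hξ (t : ℝ) : star (t : ℂ) * (1 * t) = (t : ℂ) ^ 2 := by
    rw [Complex.star_def, Complex.conj_ofReal, one_mul, sq]
  simp only [matC, Matrix.mulVec_diagonal, dotProduct, column, vecH, Fintype.sum_sum_type,
    Pi.star_apply, Sum.elim_inl, Sum.elim_inr, Finset.univ_unique, Finset.sum_singleton, hI, hξ]
  push_cast
  simp only [one_mul]

variable (hD : IsDarbouxData K U ρ γ μ ξ η ζ) (hx : x ∈ U)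

include hD hx

theorem geoDarboux_apply (lam : ℂ) (a b : Idx n) :
    geoDarboux K μ ξ η ζ lam x a b = 1 / (lam ^ 2 + (μ : ℂ) ^ 2) *
      ((lam ^ 2 + (μ : ℂ) ^ 2) * (if a = b then 1 else 0) + μ / Del ξ x *
        (Complex.I * lam * (matSigma n a a - matSigma n b b)
          - μ * (matSigma n a a + matSigma n b b)) *
        (vecH ξ η ζ x a * star (vecH ξ η ζ x b) * matSigma n b b * matC n K b b)) := by
  have hH : star (vecH ξ η ζ x) ⬝ᵥ (matC n K).mulVec (vecH ξ η ζ x) = 2 * (Del ξ x : ℂ) := by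
    rw [star_vecH_dotProduct, ← hD.quadric x hx, ← Del, ← two_mul, Complex.ofReal_mul,
      Complex.ofReal_ofNat]
  rw [geoDarboux, matSigma, matC, darbouxMatrix_diagonal_apply, ← matC, hH,
    mul_div_mul_left _ _ two_ne_zero]
  simp only [matC, Matrix.diagonal_apply_eq]

theorem geoDarboux_zero_inl_inl (hμ : μ ≠ 0) (i j : Fin n) :
    geoDarboux K μ ξ η ζ 0 x (Sum.inl i) (Sum.inl j) =
      (((if i = j then 1 else 0) - 2 * ξ i x * ξ j x / Del ξ x : ℝ) : ℂ) := by
  have hμ' : (μ : ℂ) ≠ 0 := Complex.ofReal_ne_zero.2 hμ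
  rw [geoDarboux_apply hD hx]
  simp only [matSigma, matC, Matrix.diagonal_apply_eq, column, vecH, Sum.elim_inl, Sum.inl.injEq,
    Complex.star_def, Complex.conj_ofReal]
  split_ifs <;> push_cast <;> field_simp <;> ring

theorem omegaT_eq_geoDarboux (hμ : μ ≠ 0) (ω : Coord n → Matrix (Fin n) (Fin n) ℝ) (i α : Fin n) :
    ((omegaT ξ ω x i α : ℝ) : ℂ) =
      ∑ j, geoDarboux K μ ξ η ζ 0 x (Sum.inl i) (Sum.inl j) * ((ω x j α : ℝ) : ℂ) := by
  simp only [geoDarboux_zero_inl_inl hD hx hμ, ← Complex.ofReal_mul, ← Complex.ofReal_sum]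
  simp [omegaT, sub_mul, Finset.sum_sub_distrib]

theorem geoDarboux_one_inl (i : Fin n) (b : Idx n) :
    geoDarboux K μ ξ η ζ 1 x (Sum.inl i) b = (((if Sum.inl i = b then 1 else 0)
      - bCoeff μ / Del ξ x * ξ i x * column (fun j => μ * ξ j x) (η · x) (K * ζ x) b : ℝ) : ℂ) := by
  have h1 : (1 : ℂ) + (μ : ℂ) ^ 2 ≠ 0 := mod_cast (by positivity : (1 : ℝ) + μ ^ 2 ≠ 0)
  rw [sub_eq_add_neg, Complex.ofReal_add, geoDarboux_apply hD hx, one_pow, mul_add, ← mul_assoc,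
    one_div_mul_cancel h1, one_mul]
  congr 1
  · split_ifs <;> simp
  · rcases b with b | b | b <;>
      simp only [matSigma, matC, Matrix.diagonal_apply_eq, column, vecH, bCoeff, Sum.elim_inl,
        Sum.elim_inr, Sum.elim_lam_const_lam_const, star_mul', Complex.star_def, Complex.conj_I,
        Complex.conj_ofReal] <;>
      push_cast <;> field_simp <;> ring_nf <;> simp only [Complex.I_sq] <;> ring

theorem geoDarboux_one_inr (a : Fin n ⊕ Unit) (b : Idx n) :
    geoDarboux K μ ξ η ζ 1 x (Sum.inr a) b = (((if Sum.inr a = b then 1 else 0)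
      + bCoeff μ / Del ξ x * Sum.elim (η · x) (fun _ => ζ x) a
        * column (ξ · x) (fun j => -(μ * η j x)) (-(μ * (K * ζ x))) b : ℝ) : ℂ) := by
  have h1 : (1 : ℂ) + (μ : ℂ) ^ 2 ≠ 0 := mod_cast (by positivity : (1 : ℝ) + μ ^ 2 ≠ 0)
  rw [geoDarboux_apply hD hx, one_pow, mul_add, ← mul_assoc, one_div_mul_cancel h1, one_mul,
    Complex.ofReal_add]
  congr 1
  · split_ifs <;> simp
  · rcases a with a | a <;> rcases b with b | b | b <;>
      simp only [matSigma, matC, Matrix.diagonal_apply_eq, column, vecH, bCoeff, Sum.elim_inl,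
        Sum.elim_inr, Sum.elim_lam_const_lam_const, star_mul', Complex.star_def, Complex.conj_I,
        Complex.conj_ofReal] <;>
      push_cast <;> field_simp <;> ring_nf <;> simp only [Complex.I_sq] <;> ring

theorem frameT_eq_geoDarboux (p q : Fin n → Coord n → Ambient n) (r : Coord n → Ambient n)
    (a : Idx n) (c : Fin (2 * n + 1)) :
    ((column (fun i => pT K μ ξ η ζ p q r i x) (fun i => qT K μ ξ η ζ p q r i x)
        (rT K μ ξ η ζ p q r x) a c : ℝ) : ℂ) =
      ∑ b, geoDarboux K μ ξ η ζ 1 x a b *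
        ((column (fun i => p i x) (fun i => q i x) (r x) b c : ℝ) : ℂ) := by
  have hpair (u v : Fin n → ℝ) (w : ℝ) :
      ∑ b, column u v w b * column (p · x) (q · x) (r x) b c
        = ((∑ j, u j • p j x) + (∑ j, v j • q j x) + w • r x) c := by
    simp [column, add_assoc]
  rcases a with i | a
  · simp only [geoDarboux_one_inl hD hx, ← Complex.ofReal_mul, ← Complex.ofReal_sum, sub_mul,
      ite_mul, one_mul, zero_mul, Finset.sum_sub_distrib, Finset.sum_ite_eq, Finset.mem_univ,
      if_true, mul_assoc _ (column _ _ _ _), ← Finset.mul_sum, hpair]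
    simp [column, pT_eq, pAxis, qAxis, Finset.smul_sum, smul_smul, mul_add, Finset.mul_sum,
      add_assoc, mul_assoc]
  · simp only [geoDarboux_one_inr hD hx, ← Complex.ofReal_mul, ← Complex.ofReal_sum, add_mul,
      ite_mul, one_mul, zero_mul, Finset.sum_add_distrib, Finset.sum_ite_eq, Finset.mem_univ,
      if_true, mul_assoc _ (column _ _ _ _), ← Finset.mul_sum, hpair]
    rcases a with i | _ <;>
      simp only [column, qT_eq, rT_eq, pAxis, qAxis, smul_add, Sum.elim_inl, Sum.elim_inr,
        Pi.add_apply, Pi.smul_apply, Pi.sub_apply, Finset.sum_apply, smul_eq_mul, Finset.mul_sum,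
        neg_smul, Finset.sum_neg_distrib, Pi.neg_apply] <;>
      push_cast <;> simp only [Finset.mul_sum, mul_add, mul_sub, mul_neg, mul_assoc] <;> ring

end DarbouxMatrix

section PositionVector

variable {n : ℕ} {K : ℝ} {U : Set (Coord n)} {ρ : Fin n → Coord n → ℝ}
  {γ : Fin n → Fin n → Coord n → ℝ} {x : Coord n}

theorem LaxSystem.hasPd_pd_w {𝕜 F : Type*} [Field 𝕜] [NormedAddCommGroup F] [NormedSpace ℝ F]
    [Module 𝕜 F] {lam : 𝕜} {u v : Fin n → Coord n → F} {w : Coord n → F} {v' : F} {i j : Fin n}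
    (hL : LaxSystem K U ρ γ lam u v w) (hU : IsOpen U) (hx : x ∈ U) (hρ : SmoothOn (ρ j) U)
    (hv : HasPd i (v j) v' x) :
    HasPd i (pd j w) (pd i (ρ j) x • v j x + ρ j x • v') x :=
  ((hρ.hasPd hU hx i).smul hv).congr_of_eqOn hU hx fun y hy => hL.w_eq y hy j

theorem GaussCodazzi.sum_erase_mul_pd_rho (hG : GaussCodazzi K U ρ γ) (hx : x ∈ U) (j : Fin n)
    (f : Fin n → ℝ) :
    ∑ k ∈ Finset.univ.erase j, f k * pd j (ρ k) x = -((∑ k, γ k j x * f k) * ρ j x) := by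
  rw [← Finset.sum_erase Finset.univ (a := j) (by rw [hG.diag x hx, zero_mul]), Finset.sum_mul,
    ← Finset.sum_neg_distrib]
  refine Finset.sum_congr rfl fun k hk => ?_
  linear_combination f k * hG.eq₄ x hx k j (Finset.ne_of_mem_erase hk)

variable {μ : ℝ} {ξ η : Fin n → Coord n → ℝ} {ζ : Coord n → ℝ}
  {p q : Fin n → Coord n → Ambient n} {r : Coord n → Ambient n}

theorem positionT_summand_eq (hU : IsOpen U) (hG : GaussCodazzi K U ρ γ)
    (hL : LaxSystem K U ρ γ (1 : ℝ) p q r) (hx : x ∈ U) {j : Fin n} (hρ : ρ j x ≠ 0) :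
    (bCoeff μ * ζ x * ξ j x / (Del ξ x * ρ j x)) • pd j (pd j r) x
      + (bCoeff μ * ζ x / (Del ξ x * ρ j x ^ 2) *
        (-(ξ j x * pd j (ρ j) x) + (∑ k ∈ Finset.univ.erase j, ξ k x * pd j (ρ k) x)
          - μ * ρ j x * η j x)) • pd j r x
      = (bCoeff μ / Del ξ x * ζ x) •
        ((∑ k, (ξ j x * γ j k x) • q k x) - (∑ k, γ k j x * ξ k x) • q j x
          + (ξ j x • p j x - (μ * η j x) • q j x) - (K * ρ j x * ξ j x) • r x) := by
  have hr := (hL.hasPd_pd_w hU hx (hG.smooth_rho j) (hL.hasRotPd_v hU hx j).diag).pd_eq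
  rw [hr, hL.w_eq x hx, hG.sum_erase_mul_pd_rho hx,
    Finset.sum_erase _ (by rw [hG.diag x hx, zero_smul])]
  simp only [mul_smul (ξ j x), ← Finset.smul_sum]
  match_scalars <;> field_simp
  ring

theorem rT_eq_positionT (hU : IsOpen U) (hG : GaussCodazzi K U ρ γ)
    (hL : LaxSystem K U ρ γ (1 : ℝ) p q r) (hx : x ∈ U) (hρ : ∀ i, ρ i x ≠ 0) :
    rT K μ ξ η ζ p q r x = positionT K μ ξ η ζ ρ r x := by
  have hcancel : ∑ j, ∑ k, (ξ j x * γ j k x) • q k x = ∑ j, (∑ k, γ k j x * ξ k x) • q j x := by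
    rw [Finset.sum_comm]
    simp only [Finset.sum_smul, mul_comm]
  have hr : ∑ j, K * bCoeff μ * ζ x * ρ j x * ξ j x / Del ξ x
      = bCoeff μ / Del ξ x * ζ x * ∑ j, K * ρ j x * ξ j x := by
    rw [Finset.mul_sum]
    exact Finset.sum_congr rfl fun j _ => by ring
  have hη : ∑ j, (μ * η j x) • q j x = μ • ∑ j, η j x • q j x := by
    simp only [mul_smul, Finset.smul_sum]
  rw [positionT, ← Finset.sum_add_distrib,
    Finset.sum_congr rfl fun j _ => positionT_summand_eq hU hG hL hx (hρ j), ← Finset.smul_sum,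
    hr]
  simp only [Finset.sum_sub_distrib, Finset.sum_add_distrib]
  rw [hcancel, sub_self, zero_add, ← Finset.sum_smul, hη, rT_eq, pAxis, qAxis]
  module

end PositionVector

section Restriction

variable {n : ℕ} {K : ℝ} {U W : Set (Coord n)} {ρ : Fin n → Coord n → ℝ}
  {γ : Fin n → Fin n → Coord n → ℝ}

theorem GaussCodazzi.mono (h : GaussCodazzi K U ρ γ) (hW : W ⊆ U) : GaussCodazzi K W ρ γ :=
  ⟨fun i => (h.smooth_rho i).mono hW, fun i j => (h.smooth_gamma i j).mono hW,
    fun x hx => h.diag x (hW hx), fun x hx => h.eq₁ x (hW hx), fun x hx => h.eq₂ x (hW hx),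
    fun x hx => h.eq₃ x (hW hx), fun x hx => h.eq₄ x (hW hx)⟩

theorem OmegaSystem.mono {ω : Coord n → Matrix (Fin n) (Fin n) ℝ} (h : OmegaSystem U γ ω)
    (hW : W ⊆ U) : OmegaSystem W γ ω :=
  ⟨fun i α => (h.smooth i α).mono hW, fun x hx => h.orthogonal x (hW hx),
    fun x hx => h.offdiag x (hW hx), fun x hx => h.diag x (hW hx)⟩

theorem IsMovingFrame.mono {p q : Fin n → Coord n → Ambient n} {r : Coord n → Ambient n}
    (h : IsMovingFrame K U ρ γ p q r) (hW : W ⊆ U) : IsMovingFrame K W ρ γ p q r :=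
  .of_isAdaptedFrame
    ⟨fun i => (h.structure_eq.smooth_u i).mono hW, fun i => (h.structure_eq.smooth_v i).mono hW,
      h.structure_eq.smooth_w.mono hW, fun x hx => h.structure_eq.u_diag x (hW hx),
      fun x hx => h.structure_eq.u_offdiag x (hW hx), fun x hx => h.structure_eq.v_diag x (hW hx),
      fun x hx => h.structure_eq.v_offdiag x (hW hx), fun x hx => h.structure_eq.w_eq x (hW hx)⟩
    fun _ hx => h.isAdaptedFrame (hW hx)

theorem isOpen_setOf_forall_ne_zero {ι X M : Type*} [Finite ι] [TopologicalSpace X]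
    [TopologicalSpace M] [T1Space M] [Zero M] {U : Set X} {f : ι → X → M} (hU : IsOpen U)
    (h : ∀ i, ContinuousOn (f i) U) : IsOpen {x ∈ U | ∀ i, f i x ≠ 0} := by
  rw [isOpen_iff_mem_nhds]
  rintro x ⟨hx, h0⟩
  refine Filter.Eventually.and (hU.mem_nhds hx) (Filter.eventually_all.2 fun i => ?_)
  exact ((h i).continuousAt (hU.mem_nhds hx)).eventually_ne (h0 i)

end Restriction

section Connections

variable {n : ℕ} {U : Set (Coord n)} {x : Coord n}

/-- The curvature `∂ᵢAⱼ - ∂ⱼAᵢ + [Aᵢ, Aⱼ]` of the connection `d + ∑ Aᵢ dxᵢ`, where `A i l k` is the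
entry of `Aᵢ` in row `l` and column `k`. With the Christoffel symbols for `A`, this is the curvature
tensor `riemann`. -/
noncomputable def connectionCurvature (A : Fin n → Fin n → Fin n → Coord n → ℝ) (l k i j : Fin n)
    (x : Coord n) : ℝ :=
  pd i (A j l k) x - pd j (A i l k) x
    + ∑ m, (A i l m x * A j m k x - A j l m x * A i m k x)

theorem riemann_eq_connectionCurvature (g : Coord n → Matrix (Fin n) (Fin n) ℝ) (l k i j : Fin n) :
    riemann g l k i j = connectionCurvature (fun i l k => christoffel g l i k) l k i j := rfl

theorem mul_connectionCurvature_eq_of_gauge (hU : IsOpen U) (hx : x ∈ U)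
    {A Γ : Fin n → Fin n → Fin n → Coord n → ℝ} {ρ : Fin n → Coord n → ℝ}
    (hA : ∀ i l k, SmoothOn (A i l k) U) (hΓ : ∀ i l k, SmoothOn (Γ i l k) U)
    (hρ : ∀ k, SmoothOn (ρ k) U)
    (h : ∀ y ∈ U, ∀ i l k,
      ρ l y * Γ i l k y = (if l = k then pd i (ρ k) y else 0) + A i l k y * ρ k y)
    (l k i j : Fin n) :
    ρ l x * connectionCurvature Γ l k i j x = connectionCurvature A l k i j x * ρ k x := by
  have hpd (i j : Fin n) : pd i (ρ l) x * Γ j l k x + ρ l x * pd i (Γ j l k) x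
      = (if l = k then pd i (pd j (ρ k)) x else 0)
        + (pd i (A j l k) x * ρ k x + A j l k x * pd i (ρ k) x) := by
    refine (((hρ l).hasPd hU hx i).mul ((hΓ j l k).hasPd hU hx i)).unique
      (HasPd.congr_of_eqOn (.add ?_ (((hA j l k).hasPd hU hx i).mul ((hρ k).hasPd hU hx i)))
        hU hx fun y hy => h y hy j l k)
    split_ifs
    · exact (smoothOn_pd (hρ k) hU j).hasPd hU hx i
    · exact .const i 0 x
  have hsum (i j : Fin n) : ρ l x * ∑ m, Γ i l m x * Γ j m k x
      = pd i (ρ l) x * Γ j l k x + A i l k x * pd j (ρ k) x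
        + (∑ m, A i l m x * A j m k x) * ρ k x := by
    have hm (m : Fin n) : ρ l x * (Γ i l m x * Γ j m k x)
        = (if l = m then pd i (ρ m) x * Γ j m k x else 0)
          + (if m = k then A i l m x * pd j (ρ k) x else 0)
          + A i l m x * A j m k x * ρ k x := by
      rw [← mul_assoc, h x hx, add_mul, ite_mul, zero_mul, mul_assoc, h x hx, mul_add, mul_ite,
        mul_zero, mul_assoc (A i l m x), ← add_assoc]
    simp only [Finset.mul_sum, hm, Finset.sum_add_distrib, Finset.sum_ite_eq, Finset.sum_ite_eq',
      Finset.mem_univ, if_true, Finset.sum_mul]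
  rw [connectionCurvature, connectionCurvature, Finset.sum_sub_distrib, Finset.sum_sub_distrib]
  have hcomm : (if l = k then pd i (pd j (ρ k)) x else 0)
      = if l = k then pd j (pd i (ρ k)) x else 0 := by
    rw [pd_comm (hρ k) hU hx i j]
  linear_combination hpd i j - hpd j i + hsum i j - hsum j i + hcomm

/-- The connection `Aᵢ = ∑ₗ γᵢₗ (Eₗᵢ - Eᵢₗ)` of the metric `∑ ρᵢ² dxᵢ²`, where `∂ₗρᵢ = -γᵢₗ ρₗ`, in
the orthonormal frame `ρᵢ⁻¹ ∂ᵢ`; `rotationConnection γ i l k` is the entry of `Aᵢ` in row `l` and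
column `k`. -/
noncomputable def rotationConnection (γ : Fin n → Fin n → Coord n → ℝ) (i l k : Fin n)
    (x : Coord n) : ℝ :=
  (if i = k then γ i l x else 0) - (if i = l then γ i k x else 0)

theorem smoothOn_rotationConnection {γ : Fin n → Fin n → Coord n → ℝ}
    (hγ : ∀ i j, SmoothOn (γ i j) U) (i l k : Fin n) :
    SmoothOn (rotationConnection γ i l k) U := by
  refine ContDiffOn.sub ?_ ?_ <;> split_ifs
  exacts [hγ i l, contDiffOn_const, hγ i k, contDiffOn_const]

theorem hasPd_rotationConnection (hU : IsOpen U) (hx : x ∈ U) {γ : Fin n → Fin n → Coord n → ℝ}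
    (hγ : ∀ i j, SmoothOn (γ i j) U) (i j l k : Fin n) :
    HasPd i (rotationConnection γ j l k)
      ((if j = k then pd i (γ j l) x else 0) - (if j = l then pd i (γ j k) x else 0)) x := by
  refine HasPd.sub ?_ ?_ <;> split_ifs
  exacts [(hγ j l).hasPd hU hx i, .const i 0 x, (hγ j k).hasPd hU hx i, .const i 0 x]

theorem sum_rotationConnection_mul (γ : Fin n → Fin n → Coord n → ℝ) {i j : Fin n} (hij : i ≠ j)
    (l k : Fin n) :
    ∑ m, rotationConnection γ i l m x * rotationConnection γ j m k x
      = (if j = k then γ i l x * γ j i x else 0)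
        - (if i = l then if j = k then ∑ m, γ i m x * γ j m x else 0 else 0)
        + (if i = l then γ i j x * γ j k x else 0) := by
  have hm (m : Fin n) : rotationConnection γ i l m x * rotationConnection γ j m k x
      = (if i = m then if j = k then γ i l x * γ j m x else 0 else 0)
        - (if i = l then if j = k then γ i m x * γ j m x else 0 else 0)
        + (if j = m then if i = l then γ i m x * γ j k x else 0 else 0) := by
    have hmm : i = m → j ≠ m := fun him hjm => hij (him.trans hjm.symm)
    simp only [rotationConnection]
    split_ifs with him <;> grind
  simp only [hm, Finset.sum_add_distrib, Finset.sum_sub_distrib, Finset.sum_ite_eq,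
    Finset.mem_univ, if_true]
  split_ifs <;> simp

end Connections

section Curvature

variable {n : ℕ} {K : ℝ} {U : Set (Coord n)} {ρ : Fin n → Coord n → ℝ}
  {γ : Fin n → Fin n → Coord n → ℝ} {g : Coord n → Matrix (Fin n) (Fin n) ℝ} {x : Coord n}

theorem GaussCodazzi.pd_gamma_add (hU : IsOpen U) (hG : GaussCodazzi K U ρ γ) (hx : x ∈ U)
    {i j : Fin n} (hij : i ≠ j) (l : Fin n) :
    pd i (γ j l) x + γ j i x * γ i l x
      = (if i = l then pd i (γ j i) x else 0) + (if j = l then γ j i x * γ i j x else 0) := by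
  rcases eq_or_ne i l with rfl | hil
  · rw [hG.diag x hx, if_pos rfl, if_neg hij.symm, mul_zero]
  rcases eq_or_ne j l with rfl | hjl
  · have h0 : HasPd i (γ j j) 0 x :=
      HasPd.congr_of_eqOn (.const i 0 x) hU hx fun y hy => hG.diag y hy j
    rw [h0.pd_eq, if_neg hil, if_pos rfl]
  · rw [hG.eq₂ x hx j l i hjl hij.symm hil.symm, if_neg hil, if_neg hjl, add_zero]

theorem connectionCurvature_rotationConnection (hU : IsOpen U) (hG : GaussCodazzi K U ρ γ)
    (hx : x ∈ U) (l k i j : Fin n) :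
    connectionCurvature (rotationConnection γ) l k i j x
      = K * (ρ i x * ρ j x) * ((if i = l then 1 else 0) * (if j = k then 1 else 0)
        - (if j = l then 1 else 0) * (if i = k then 1 else 0)) := by
  rcases eq_or_ne i j with rfl | hij
  · simp [connectionCurvature]
  have h₃ := hG.eq₃ x hx i j hij
  rw [sum_erase_erase_eq_sub_sub hij, hG.diag x hx, hG.diag x hx] at h₃
  have hil := hG.pd_gamma_add hU hx hij l
  have hik := hG.pd_gamma_add hU hx hij k
  have hjl := hG.pd_gamma_add hU hx hij.symm l
  have hjk := hG.pd_gamma_add hU hx hij.symm k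
  have hpd := hasPd_rotationConnection hU hx hG.smooth_gamma
  rw [connectionCurvature, (hpd i j l k).pd_eq, (hpd j i l k).pd_eq, Finset.sum_sub_distrib,
    sum_rotationConnection_mul γ hij, sum_rotationConnection_mul γ hij.symm]
  simp only [mul_comm (γ j _ x) (γ i _ x)]
  linear_combination (norm := (split_ifs <;> ring))
    (if j = k then 1 else 0) * hil - (if j = l then 1 else 0) * hik
      - (if i = k then 1 else 0) * hjl + (if i = l then 1 else 0) * hjk
      + ((if i = l then 1 else 0) * (if j = k then 1 else 0)
        - (if j = l then 1 else 0) * (if i = k then 1 else 0)) * h₃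

theorem inv_eq_diagonal {ι 𝕜 : Type*} [Fintype ι] [DecidableEq ι] [Field 𝕜] {A : Matrix ι ι 𝕜}
    {d : ι → 𝕜} (hA : ∀ i j, A i j = if i = j then d i ^ 2 else 0) (hd : ∀ i, d i ≠ 0) :
    A⁻¹ = Matrix.diagonal fun i => (d i ^ 2)⁻¹ := by
  have hdiag : A = Matrix.diagonal fun i => d i ^ 2 := by
    ext i j
    rw [hA, Matrix.diagonal_apply]
  refine Matrix.inv_eq_left_inv ?_
  rw [hdiag, Matrix.diagonal_mul_diagonal, ← Matrix.diagonal_one]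
  exact congrArg _ (funext fun i => inv_mul_cancel₀ (pow_ne_zero 2 (hd i)))

theorem mul_christoffel_of_diagonal (hU : IsOpen U) (hρs : ∀ i, SmoothOn (ρ i) U)
    (hg : ∀ x ∈ U, ∀ i j, g x i j = if i = j then ρ i x ^ 2 else 0) (hx : x ∈ U)
    (hρ : ∀ i, ρ i x ≠ 0) (l i k : Fin n) :
    ρ l x * christoffel g l i k x = (if l = k then pd i (ρ k) x else 0)
      + (if i = l then pd k (ρ i) x else 0)
      - (if i = k then ρ i x / ρ l x * pd l (ρ i) x else 0) := by
  have hpd (a b c : Fin n) : pd a (fun y => g y b c) x =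
      if b = c then 2 * ρ b x * pd a (ρ b) x else 0 := by
    refine (HasPd.congr_of_eqOn ?_ hU hx fun y hy => hg y hy b c).pd_eq
    split_ifs
    · have hb := (hρs b).hasPd hU hx a
      simpa only [sq] using (hb.mul hb).congr_deriv (by ring)
    · exact .const a 0 x
  rw [christoffel, inv_eq_diagonal (hg x hx) hρ]
  simp only [Matrix.diagonal_apply, ite_mul, zero_mul, Finset.sum_ite_eq, Finset.mem_univ, if_true,
    hpd]
  have hl := hρ l
  rcases eq_or_ne i k with rfl | hik
  · rcases eq_or_ne i l with rfl | hil
    · simp only [if_true]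
      field_simp
    · simp only [if_true, if_neg hil, if_neg hil.symm]
      field_simp
      ring
  · rcases eq_or_ne i l with rfl | hil
    · simp only [if_true, if_neg hik, if_neg hik.symm]
      field_simp
      ring
    · rcases eq_or_ne l k with rfl | hlk
      · simp only [if_true, if_neg hik]
        field_simp
        ring
      · simp [hik, hil, hlk, hlk.symm]

theorem GaussCodazzi.mul_christoffel (hU : IsOpen U) (hG : GaussCodazzi K U ρ γ)
    (hg : ∀ x ∈ U, ∀ i j, g x i j = if i = j then ρ i x ^ 2 else 0) (hx : x ∈ U)
    (hρ : ∀ i, ρ i x ≠ 0) (i l k : Fin n) :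
    ρ l x * christoffel g l i k x
      = (if l = k then pd i (ρ k) x else 0) + rotationConnection γ i l k x * ρ k x := by
  have hoff (i l : Fin n) (hil : i ≠ l) : pd l (ρ i) x = -(γ i l x * ρ l x) :=
    eq_neg_of_add_eq_zero_left (hG.eq₄ x hx i l hil)
  rw [mul_christoffel_of_diagonal hU hG.smooth_rho hg hx hρ, rotationConnection, add_sub_assoc]
  congr 1
  have hl := hρ l
  rcases eq_or_ne i l with rfl | hil
  · rcases eq_or_ne i k with rfl | hik
    · simp [hl]
    · simp [hik, hoff i k hik]
  · rcases eq_or_ne i k with rfl | hik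
    · simp only [if_neg hil, if_true, hoff i l hil]
      field_simp
      ring
    · simp [hil, hik]

theorem GaussCodazzi.hasConstantCurvature (hU : IsOpen U) (hG : GaussCodazzi K U ρ γ)
    (hg : ∀ x ∈ U, ∀ i j, g x i j = if i = j then ρ i x ^ 2 else 0)
    (hρ : ∀ x ∈ U, ∀ i, ρ i x ≠ 0) : HasConstantCurvature K U g := by
  intro x hx l k i j
  have hgauge := fun y hy => hG.mul_christoffel hU hg hy (hρ y hy)
  have hA := smoothOn_rotationConnection hG.smooth_gamma
  have hΓ (i l k : Fin n) : SmoothOn (christoffel g l i k) U := by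
    refine ((((hG.smooth_rho l).inv fun y hy => hρ y hy l).mul
      (ContDiffOn.add ?_ ((hA i l k).mul (hG.smooth_rho k)))).congr
        fun y hy => (eq_inv_mul_iff_mul_eq₀ (hρ y hy l)).2 (hgauge y hy i l k))
    split_ifs
    exacts [smoothOn_pd (hG.smooth_rho k) hU i, contDiffOn_const]
  refine mul_left_cancel₀ (hρ x hx l) ?_
  rw [riemann_eq_connectionCurvature,
    mul_connectionCurvature_eq_of_gauge hU hx hA hΓ hG.smooth_rho hgauge,
    connectionCurvature_rotationConnection hU hG hx, hg x hx, hg x hx]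
  split_ifs <;> grind

end Curvature

section Immersion

variable {n : ℕ} {K : ℝ} {U : Set (Coord n)} {ρ : Fin n → Coord n → ℝ}
  {γ : Fin n → Fin n → Coord n → ℝ} {ω : Coord n → Matrix (Fin n) (Fin n) ℝ}
  {p q : Fin n → Coord n → Ambient n} {r : Coord n → Ambient n} {x : Coord n} {ν : Ambient n}

theorem IsAdaptedFrame.ambientForm_p_normalOf (h : IsAdaptedFrame K (p · x) (q · x) (r x))
    (i α : Fin n) : ambientForm K (p i x) (normalOf ω p α x) = ω x i α := by
  simp [normalOf, h.inner_pp]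

theorem IsAdaptedFrame.normalOf (h : IsAdaptedFrame K (p · x) (q · x) (r x))
    (hω : ω x ∈ Matrix.orthogonalGroup (Fin n) ℝ) :
    IsAdaptedFrame K (normalOf ω p · x) (q · x) (r x) :=
  h.mul_orthogonal (A := (ω x).transpose) (Unitary.star_mem hω)

namespace IsMovingFrame

theorem mem_normalSpace_iff (hF : IsMovingFrame K U ρ γ p q r) (hρ : ∀ i, ρ i x ≠ 0)
    (hx : x ∈ U) : ν ∈ normalSpace K r x ↔
      ν ∈ spaceFormTangent K (r x) ∧ ∀ i, ambientForm K (q i x) ν = 0 := by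
  refine and_congr_right fun _ => forall_congr' fun i => ?_
  rw [hF.structure_eq.w_eq x hx, ← ambientForm_apply, map_smul, smul_eq_mul,
    mul_eq_zero_iff_left (hρ i), ambientForm_comm]

theorem inducedMetric_eq (hF : IsMovingFrame K U ρ γ p q r) (hx : x ∈ U) (i j : Fin n) :
    inducedMetric K r x i j = if i = j then ρ i x ^ 2 else 0 := by
  rw [inducedMetric, Matrix.of_apply, hF.structure_eq.w_eq x hx, hF.structure_eq.w_eq x hx,
    ← ambientForm_apply, map_smul, map_smul, LinearMap.smul_apply, ambientForm_apply,
    hF.inner_qq x hx]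
  rcases eq_or_ne i j with rfl | hij
  · simp [sq]
  · simp [hij]

theorem ambientForm_pd_pd (hU : IsOpen U) (hρs : ∀ i, SmoothOn (ρ i) U)
    (hF : IsMovingFrame K U ρ γ p q r) (hρ : ∀ i, ρ i x ≠ 0) (hx : x ∈ U) (i j : Fin n)
    (hν : ν ∈ normalSpace K r x) :
    ambientForm K (pd i (pd j r) x) ν = if i = j then ρ i x * ambientForm K (p i x) ν else 0 := by
  obtain ⟨hνr, hνq⟩ := (hF.mem_normalSpace_iff hρ hx).1 hν
  have hv := HasRotPd.iff_forall_hasPd.1 (hF.structure_eq.hasRotPd_v hU hx i) j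
  rw [(hF.structure_eq.hasPd_pd_w hU hx (hρs j) hv).pd_eq]
  rcases eq_or_ne i j with rfl | hij
  · simp only [if_true, map_add, map_sub, map_neg, map_sum, map_smul, LinearMap.add_apply,
      LinearMap.sub_apply, LinearMap.neg_apply, LinearMap.sum_apply, LinearMap.smul_apply, hνq,
      smul_eq_mul, mul_zero, Finset.sum_const_zero]
    linear_combination -ρ i x ^ 2 * mul_ambientForm_of_mem_tangent hνr
  · simp [hij, hij.symm, hνq]

theorem isParallelNormalFrame (hU : IsOpen U) (hF : IsMovingFrame K U ρ γ p q r)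
    (hω : OmegaSystem U γ ω) (hρ : ∀ x ∈ U, ∀ i, ρ i x ≠ 0) :
    IsParallelNormalFrame K U r (normalOf ω p) where
  smooth α := ContDiffOn.sum fun i _ => (hω.smooth i α).smul (hF.structure_eq.smooth_u i)
  normal x hx α := by
    have hN := (hF.isAdaptedFrame hx).normalOf (hω.orthogonal x hx)
    exact (hF.mem_normalSpace_iff (hρ x hx) hx).2 ⟨hN.p_tangent α, fun i => hN.inner_qp i α⟩
  orthonormal x hx := ((hF.isAdaptedFrame hx).normalOf (hω.orthogonal x hx)).inner_pp
  parallel x hx α i ν hν := by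
    have hpd : HasPd i (normalOf ω p α) _ x :=
      (hω.hasRotPd hU hx i α).sum_smul (hF.structure_eq.hasRotPd_u hU hx i)
    rw [← ambientForm_apply, hpd.pd_eq]
    simp [((hF.mem_normalSpace_iff (hρ x hx) hx).1 hν).2]

theorem hasPrincipalForms (hU : IsOpen U) (hG : GaussCodazzi K U ρ γ)
    (hF : IsMovingFrame K U ρ γ p q r) (hω : OmegaSystem U γ ω) (hρ : ∀ x ∈ U, ∀ i, ρ i x ≠ 0) :
    HasPrincipalForms K U r ρ ω (normalOf ω p) where
  smooth := hF.structure_eq.smooth_w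
  smooth_rho := hG.smooth_rho
  smooth_omega := hω.smooth
  mem := hF.mem
  rho_ne_zero := hρ
  orthogonal := hω.orthogonal
  frame := hF.isParallelNormalFrame hU hω hρ
  first x hx := hF.inducedMetric_eq hx
  second x hx i j α := by
    have hν := (hF.isParallelNormalFrame hU hω hρ).normal x hx α
    rw [← ambientForm_apply, hF.ambientForm_pd_pd hU hG.smooth_rho (hρ x hx) hx i j hν,
      (hF.isAdaptedFrame hx).ambientForm_p_normalOf]

theorem eq_of_isCurvatureNormal (hU : IsOpen U) (hρs : ∀ i, SmoothOn (ρ i) U)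
    (hF : IsMovingFrame K U ρ γ p q r) (hρ : ∀ i, ρ i x ≠ 0) (hx : x ∈ U)
    {h : Ambient n} (hh : IsCurvatureNormal K r x h) : ∃ j, (ρ j x)⁻¹ • p j x = h := by
  obtain ⟨hN, X, hX, hII⟩ := hh
  obtain ⟨j, hj : X j ≠ 0⟩ := Function.ne_iff.1 hX
  have hA := hF.isAdaptedFrame hx
  have hpj : (ρ j x)⁻¹ • p j x ∈ spaceFormTangent K (r x) :=
    (tangentSubmodule K (r x)).smul_mem _ (hA.p_tangent j)
  obtain ⟨hNr, hNq⟩ := (hF.mem_normalSpace_iff hρ hx).1 hN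
  refine ⟨j, hA.ext hpj hNr (fun i => ?_) fun i => by rw [map_smul, hA.inner_qp, hNq, smul_zero]⟩
  have hpi : p i x ∈ normalSpace K r x :=
    (hF.mem_normalSpace_iff hρ hx).2 ⟨hA.p_tangent i, fun k => hA.inner_qp k i⟩
  have hIIj := hII (Pi.single j 1) (p i x) hpi
  simp only [← ambientForm_apply, hF.ambientForm_pd_pd hU hρs hρ hx _ _ hpi,
    hF.inducedMetric_eq hx, Pi.single_apply, mul_ite, ite_mul, mul_zero, mul_one, zero_mul,
    Finset.sum_ite_eq, Finset.sum_ite_eq', Finset.mem_univ, if_true] at hIIj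
  rw [map_smul, smul_eq_mul, ambientForm_comm (p i x), ambientForm_comm (p i x)]
  refine mul_left_cancel₀ (mul_ne_zero hj (pow_ne_zero 2 (hρ j))) ((Eq.trans ?_ hIIj))
  have h0 := hρ j
  field_simp

theorem isSpaceFormImmersion (hU : IsOpen U) (hG : GaussCodazzi K U ρ γ)
    (hF : IsMovingFrame K U ρ γ p q r) (hω : OmegaSystem U γ ω) (hρ : ∀ x ∈ U, ∀ i, ρ i x ≠ 0) :
    IsSpaceFormImmersion K U r where
  smooth := hF.structure_eq.smooth_w
  mem := hF.mem
  immersion x hx := by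
    simp only [hF.structure_eq.w_eq x hx]
    exact (linearIndependent_of_orthonormal (hF.isAdaptedFrame hx).inner_qq).units_smul
      fun i => Units.mk0 (ρ i x) (hρ x hx i)
  curvature := hG.hasConstantCurvature hU (fun _ hx => hF.inducedMetric_eq hx) hρ
  flat x hx := ⟨U, hU, hx, subset_rfl, _, hF.isParallelNormalFrame hU hω hρ⟩
  curvatureNormals x hx := by
    have hli : LinearIndependent ℝ fun j => (ρ j x)⁻¹ • p j x :=
      (linearIndependent_of_orthonormal (hF.isAdaptedFrame hx).inner_pp).units_smul
        fun i => (Units.mk0 (ρ i x) (hρ x hx i))⁻¹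
    exact hli.linearIndepOn_id.mono fun h hh =>
      hF.eq_of_isCurvatureNormal hU hG.smooth_rho (hρ x hx) hx hh

end IsMovingFrame

end Immersion

section StructureEquations

variable {n : ℕ} {K : ℝ} {U : Set (Coord n)} {ρ : Fin n → Coord n → ℝ}
  {γ : Fin n → Fin n → Coord n → ℝ} {p q : Fin n → Coord n → Ambient n}
  {r : Coord n → Ambient n}

theorem IsMovingFrame.pd_rho_add_mul_eq_zero (hU : IsOpen U) (hF : IsMovingFrame K U ρ γ p q r)
    (hρ : ∀ i, SmoothOn (ρ i) U) {x : Coord n} (hx : x ∈ U) {i j : Fin n} (hij : i ≠ j) :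
    pd j (ρ i) x + γ i j x * ρ j x = 0 := by
  have hA := hF.isAdaptedFrame hx
  have hL := hF.structure_eq
  have hpd {i j : Fin n} (h : i ≠ j) :=
    (hL.hasPd_pd_w hU hx (hρ i) ((hL.hasRotPd_v hU hx j).offdiag i h)).pd_eq
  have hcomm := congrArg (ambientForm K (q i x)) (pd_comm hL.smooth_w hU hx j i)
  simp only [hpd hij, hpd hij.symm, map_add, map_neg, map_smul, hA.inner_qq, if_true, if_neg hij,
    smul_eq_mul] at hcomm
  linear_combination hcomm

theorem IsMovingFrame.gaussCodazzi (hU : IsOpen U) (hF : IsMovingFrame K U ρ γ p q r)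
    (hρ : ∀ i, SmoothOn (ρ i) U) (hγ : ∀ i j, SmoothOn (γ i j) U)
    (hdiag : ∀ x ∈ U, ∀ i, γ i i x = 0) :
    GaussCodazzi K U ρ γ where
  smooth_rho := hρ
  smooth_gamma := hγ
  diag := hdiag
  eq₁ x hx i j hij := by
    have hA := hF.isAdaptedFrame hx
    have hL := hF.structure_eq
    have hα := ((hL.hasRotPd_v hU hx j).offdiag i hij).clm (-.id ℝ (Ambient n))
    rw [HasRotPd.pd_add_pd_eq hU hL.smooth_u hγ
      (fun y hy j => by simpa only [one_smul] using hL.hasRotPd_u hU hy j) hx hij hα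
      (ambientForm K (p j x)) fun l => by simp only [hA.inner_pp, eq_comm]]
    simp [hA.inner_pq]
  eq₂ x hx i j k hij hik hjk := by
    have hA := hF.isAdaptedFrame hx
    have hL := hF.structure_eq
    exact HasRotPd.pd_add_mul_eq_zero hU hL.smooth_u hγ (fun y hy j => hL.hasRotPd_u hU hy j) hx
      hij hik hjk (ambientForm K (p j x)) fun l => by simp only [hA.inner_pp, eq_comm]
  eq₃ x hx i j hij := by
    have hA := hF.isAdaptedFrame hx
    have hL := hF.structure_eq
    have hr := mul_ambientForm_of_mem_tangent (hA.q_tangent j)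
    rw [ambientForm_comm] at hr
    have hα := ((hL.hasRotPd_u hU hx j).offdiag i hij).sub
      ((((hρ i).hasPd hU hx j).mul (.const j K x)).smul (hL.hasPd_w hU hx j))
    rw [HasRotPd.pd_add_pd_eq (g := fun i j => γ j i) hU hL.smooth_v (fun i j => hγ j i)
      (fun y hy j => by simpa only [one_smul] using hL.hasRotPd_v hU hy j) hx hij
      (by simpa only [mul_comm K] using hα)
      (ambientForm K (q j x)) fun l => by simp only [hA.inner_qq, eq_comm]]
    simp only [map_sub, map_neg, map_add, map_smul, hA.inner_qp, hA.inner_qq, smul_eq_mul,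
      if_true, mul_zero, mul_one, neg_zero, add_zero]
    linear_combination (γ i j x * ρ j x + pd j (ρ i) x) * hr
  eq₄ _ hx _ _ hij := hF.pd_rho_add_mul_eq_zero hU hρ hx hij

end StructureEquations

section PrincipalForms

variable {n : ℕ} {K : ℝ} {U : Set (Coord n)} {V : Coord n → Ambient n} {x : Coord n}

theorem christoffel_inducedMetric (hU : IsOpen U) (hV : SmoothOn V U) (hx : x ∈ U)
    (k i j : Fin n) : christoffel (inducedMetric K V) k i j x =
      ∑ l, (inducedMetric K V x)⁻¹ k l * ambientForm K (pd i (pd j V) x) (pd l V x) := by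
  have hpd (a b c : Fin n) : pd a (fun y => inducedMetric K V y b c) x =
      ambientForm K (pd a (pd b V) x) (pd c V x) + ambientForm K (pd a (pd c V) x) (pd b V x) := by
    have hb (b : Fin n) := (smoothOn_pd hV hU b).hasPd hU hx a
    exact ((hb b).inner (hb c)).pd_eq.trans (congrArg _ (ambientForm_comm _ _))
  rw [christoffel, Finset.mul_sum]
  refine Finset.sum_congr rfl fun l _ => ?_
  rw [hpd, hpd, hpd, pd_comm hV hU hx j i, pd_comm hV hU hx l i, pd_comm hV hU hx l j]
  ring

theorem pd_mem_spaceFormTangent (hU : IsOpen U) (hx : x ∈ U) {V' : Ambient n} {j : Fin n}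
    (hV : HasPd j V V' x) (hmem : ∀ y ∈ U, V y ∈ spaceForm n K) :
    V' ∈ spaceFormTangent K (V x) := by
  refine ⟨fun h0 => ?_, fun h0 => ?_⟩
  · exact (hV.clm (.proj (R := ℝ) (φ := fun _ => ℝ) (Fin.last (2 * n)))).unique
      ((HasPd.const j (0 : ℝ) x).congr_of_eqOn hU hx fun y hy => (hmem y hy).1 h0)
  · have hVV := (hV.inner (K := K) hV).unique
      ((HasPd.const j K x).congr_of_eqOn hU hx fun y hy => (hmem y hy).2 h0)
    rw [ambientForm_comm V'] at hVV
    rw [← ambientForm_apply]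
    linarith

theorem pd_add_smul_mem_spaceFormTangent (hK : K * K * K = K) (hU : IsOpen U) (hx : x ∈ U)
    {f : Coord n → Ambient n} {f' V' : Ambient n} {j : Fin n} (hV : HasPd j V V' x)
    (hmem : ∀ y ∈ U, V y ∈ spaceForm n K) (hf : HasPd j f f' x)
    (hft : ∀ y ∈ U, f y ∈ spaceFormTangent K (V y)) :
    f' + (K * ambientForm K V' (f x)) • V x ∈ spaceFormTangent K (V x) := by
  refine ⟨fun h0 => ?_, fun h0 => ?_⟩
  · have hlast : f' (Fin.last (2 * n)) = 0 :=
      (hf.clm (.proj (R := ℝ) (φ := fun _ => ℝ) (Fin.last (2 * n)))).unique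
        ((HasPd.const j (0 : ℝ) x).congr_of_eqOn hU hx fun y hy => (hft y hy).1 h0)
    simp [hlast, h0]
  · have hVf := (hV.inner (K := K) hf).unique
      ((HasPd.const j (0 : ℝ) x).congr_of_eqOn hU hx fun y hy => (hft y hy).2 h0)
    have hVV := mul_ambientForm_self_of_mem (hmem x hx)
    have hKK : K * K = 1 := mul_right_cancel₀ h0 (by rw [hK, one_mul])
    rw [← ambientForm_apply, map_add, map_smul, smul_eq_mul]
    linear_combination hVf + ambientForm K V' (f x) * (hVV + hKK)

end PrincipalForms

section OffDiagonal

variable {n : ℕ} {K : ℝ} {U : Set (Coord n)} {ρ : Fin n → Coord n → ℝ}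
  {γ : Fin n → Fin n → Coord n → ℝ} {p q : Fin n → Coord n → Ambient n}
  {r : Coord n → Ambient n} {x : Coord n}

theorem ambientForm_add_eq_zero_of_const {a b : Coord n → Ambient n} {a' b' : Ambient n} {t : ℝ}
    {j : Fin n} (hU : IsOpen U) (hx : x ∈ U) (ha : HasPd j a a' x) (hb : HasPd j b b' x)
    (hab : ∀ y ∈ U, ambientForm K (a y) (b y) = t) :
    ambientForm K (b x) a' + ambientForm K (a x) b' = 0 := by
  rw [ambientForm_comm (b x)]
  exact (ha.inner hb).unique ((HasPd.const j t x).congr_of_eqOn hU hx hab)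

theorem ambientForm_pd_of_orthonormal {f : Fin n → Coord n → Ambient n} {c : Fin n → ℝ}
    {f' : Ambient n} {j : Fin n} (hU : IsOpen U) (hx : x ∈ U)
    (h : ∀ y ∈ U, ∀ i k, ambientForm K (f i y) (f k y) = if i = k then 1 else 0)
    (hdiag : HasPd j (f j) f' x) (hoff : ∀ i, i ≠ j → HasPd j (f i) (-(c i • f j x)) x)
    (i : Fin n) : ambientForm K (f i x) f' =
      ambientForm K (f i x) (∑ k ∈ Finset.univ.erase j, c k • f k x) := by
  rcases eq_or_ne i j with rfl | hij
  · have hskew := ambientForm_add_eq_zero_of_const hU hx hdiag hdiag fun y hy => h y hy i i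
    rw [map_sum, Finset.sum_eq_zero fun k hk => by
      rw [map_smul, h x hx, if_neg (Finset.ne_of_mem_erase hk).symm, smul_zero]]
    linarith
  · have hskew := ambientForm_add_eq_zero_of_const hU hx hdiag (hoff i hij) fun y hy => h y hy j i
    simp only [map_neg, map_smul, h x hx, if_true, smul_eq_mul, mul_one] at hskew
    simp only [map_sum, map_smul, h x hx, smul_eq_mul, mul_ite, mul_one, mul_zero,
      Finset.sum_ite_eq, Finset.mem_erase, ne_eq, hij, not_false_eq_true, Finset.mem_univ,
      and_self, if_true]
    linarith

theorem hasRotPd_p_of_offdiag (hK : K * K * K = K) (hU : IsOpen U) (hx : x ∈ U)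
    (hA : ∀ x ∈ U, IsAdaptedFrame K (p · x) (q · x) (r x)) {j : Fin n}
    (hp : ∀ i, i ≠ j → HasPd j (p i) (-(γ i j x • p j x)) x)
    (hq : ∀ i, i ≠ j → HasPd j (q i) (-(γ j i x • q j x)) x)
    (hr : HasPd j r (ρ j x • q j x) x) {p' : Ambient n} (hpj : HasPd j (p j) p' x)
    (hpq : ambientForm K (q j x) p' = -1) :
    HasRotPd (fun i => γ i j x) j p (-((1 : ℝ) • q j x)) x where
  offdiag := hp
  diag := by
    have hAx := hA x hx
    have hp't := pd_add_smul_mem_spaceFormTangent hK hU hx hr (fun y hy => (hA y hy).mem) hpj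
      fun y hy => (hA y hy).p_tangent j
    rw [map_smul, LinearMap.smul_apply, hAx.inner_qp, smul_zero, mul_zero, zero_smul,
      add_zero] at hp't
    refine hpj.congr_deriv (hAx.ext hp't ?_ (fun i => ?_) fun i => ?_)
    · exact (tangentSubmodule K (r x)).add_mem ((tangentSubmodule K (r x)).sum_mem fun k _ =>
        (tangentSubmodule K (r x)).smul_mem _ (hAx.p_tangent k)) ((tangentSubmodule K (r x)).neg_mem
        ((tangentSubmodule K (r x)).smul_mem _ (hAx.q_tangent j)))
    · rw [ambientForm_pd_of_orthonormal hU hx (fun y hy => (hA y hy).inner_pp) hpj hp, map_add,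
        map_neg, map_smul, hAx.inner_pq, smul_zero, neg_zero, add_zero]
    · simp only [map_add, map_neg, map_sum, map_smul, hAx.inner_qp, hAx.inner_qq, smul_zero,
        Finset.sum_const_zero, zero_add, one_smul]
      rcases eq_or_ne i j with rfl | hij
      · rw [hpq, if_pos rfl]
      · have hskew := ambientForm_add_eq_zero_of_const hU hx hpj (hq i hij)
          fun y hy => (hA y hy).inner_pq j i
        rw [map_neg, map_smul, hAx.inner_pq, smul_zero, neg_zero, add_zero] at hskew
        rw [hskew, if_neg hij, neg_zero]

theorem hasRotPd_q_of_offdiag (hK : K * K * K = K) (hU : IsOpen U) (hx : x ∈ U)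
    (hA : ∀ x ∈ U, IsAdaptedFrame K (p · x) (q · x) (r x)) {j : Fin n}
    (hp : ∀ i, i ≠ j → HasPd j (p i) (-(γ i j x • p j x)) x)
    (hq : ∀ i, i ≠ j → HasPd j (q i) (-(γ j i x • q j x)) x)
    (hr : HasPd j r (ρ j x • q j x) x) {p' q' : Ambient n} (hpj : HasPd j (p j) p' x)
    (hqj : HasPd j (q j) q' x) (hpq : ambientForm K (q j x) p' = -1) :
    HasRotPd (fun i => γ j i x) j q ((1 : ℝ) • p j x - (K * ρ j x) • r x) x where
  offdiag := hq
  diag := by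
    have hAx := hA x hx
    have hq't := pd_add_smul_mem_spaceFormTangent hK hU hx hr (fun y hy => (hA y hy).mem) hqj
      fun y hy => (hA y hy).q_tangent j
    rw [map_smul, LinearMap.smul_apply, hAx.inner_qq, if_pos rfl, smul_eq_mul, mul_one] at hq't
    rw [← add_sub_assoc]
    refine hqj.congr_deriv (eq_sub_of_add_eq (hAx.ext hq't ?_ (fun i => ?_) fun i => ?_))
    · exact (tangentSubmodule K (r x)).add_mem ((tangentSubmodule K (r x)).sum_mem fun k _ =>
        (tangentSubmodule K (r x)).smul_mem _ (hAx.q_tangent k))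
        ((tangentSubmodule K (r x)).smul_mem _ (hAx.p_tangent j))
    · have hri := mul_ambientForm_of_mem_tangent (hAx.p_tangent i)
      rw [ambientForm_comm] at hri
      simp only [map_add, map_sum, map_smul, hAx.inner_pq, hAx.inner_pp, smul_eq_mul, mul_zero,
        Finset.sum_const_zero, zero_add, one_mul]
      rcases eq_or_ne i j with rfl | hij
      · have hskew := ambientForm_add_eq_zero_of_const hU hx hpj hqj
          fun y hy => (hA y hy).inner_pq i i
        rw [if_pos rfl]
        linear_combination ρ i x * hri + hskew - hpq
      · have hskew := ambientForm_add_eq_zero_of_const hU hx (hp i hij) hqj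
          fun y hy => (hA y hy).inner_pq i j
        rw [map_neg, map_smul, hAx.inner_qp, smul_zero] at hskew
        rw [if_neg hij]
        linear_combination ρ j x * hri + hskew
    · have hri := mul_ambientForm_of_mem_tangent (hAx.q_tangent i)
      rw [ambientForm_comm] at hri
      rw [map_add, ambientForm_pd_of_orthonormal hU hx (fun y hy => (hA y hy).inner_qq) hqj hq,
        map_add, map_smul, map_smul, hAx.inner_qp, smul_eq_mul, smul_zero]
      linear_combination ρ j x * hri

end OffDiagonal

namespace HasPrincipalForms

variable {n : ℕ} {K : ℝ} {U : Set (Coord n)} {V : Coord n → Ambient n}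
  {ρ : Fin n → Coord n → ℝ} {ω : Coord n → Matrix (Fin n) (Fin n) ℝ}
  {e : Fin n → Coord n → Ambient n} {x : Coord n}

theorem pd_eq (h : HasPrincipalForms K U V ρ ω e) (hx : x ∈ U) (i : Fin n) :
    pd i V x = ρ i x • qOf ρ V i x := by
  rw [qOf, smul_inv_smul₀ (h.rho_ne_zero x hx i)]

theorem hasPd (h : HasPrincipalForms K U V ρ ω e) (hU : IsOpen U) (hx : x ∈ U) (i : Fin n) :
    HasPd i V (ρ i x • qOf ρ V i x) x :=
  SmoothOn.hasPd_of_eq h.smooth hU hx (h.pd_eq hx i)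

theorem smoothOn_qOf (h : HasPrincipalForms K U V ρ ω e) (hU : IsOpen U) (i : Fin n) :
    SmoothOn (qOf ρ V i) U :=
  ((h.smooth_rho i).inv fun x hx => h.rho_ne_zero x hx i).smul (smoothOn_pd h.smooth hU i)

theorem smoothOn_pOf (h : HasPrincipalForms K U V ρ ω e) (i : Fin n) : SmoothOn (pOf ω e i) U :=
  ContDiffOn.sum fun α _ => (h.smooth_omega i α).smul (h.frame.smooth α)

theorem smoothOn_gammaOf (h : HasPrincipalForms K U V ρ ω e) (hU : IsOpen U) (i j : Fin n) :
    SmoothOn (gammaOf ρ i j) U := by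
  rcases eq_or_ne i j with hij | hij
  · exact (contDiffOn_const (c := (0 : ℝ))).congr fun _ _ => if_pos hij
  · exact ((smoothOn_pd (h.smooth_rho i) hU j).div (h.smooth_rho j)
      fun x hx => h.rho_ne_zero x hx j).neg.congr fun x _ => if_neg hij

theorem isAdaptedFrame_normal (h : HasPrincipalForms K U V ρ ω e) (hU : IsOpen U) (hx : x ∈ U) :
    IsAdaptedFrame K (e · x) (qOf ρ V · x) (V x) where
  mem := h.mem x hx
  p_tangent α := (h.frame.normal x hx α).1
  q_tangent i := (tangentSubmodule K (V x)).smul_mem _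
    (pd_mem_spaceFormTangent hU hx (SmoothOn.hasPd h.smooth hU hx i) h.mem)
  inner_pp := h.frame.orthonormal x hx
  inner_qq i j := by
    have hI : ambientForm K (pd i V x) (pd j V x) = _ := h.first x hx i j
    have hρ := h.rho_ne_zero x hx i
    simp only [qOf, map_smul, LinearMap.smul_apply, hI, smul_eq_mul]
    rcases eq_or_ne i j with rfl | hij
    · simp only [if_true]
      field_simp
    · simp only [if_neg hij, mul_zero]
  inner_pq α i := by
    rw [qOf, map_smul, ambientForm_apply, (h.frame.normal x hx α).2, smul_zero]

theorem isAdaptedFrame (h : HasPrincipalForms K U V ρ ω e) (hU : IsOpen U) (hx : x ∈ U) :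
    IsAdaptedFrame K (pOf ω e · x) (qOf ρ V · x) (V x) :=
  (h.isAdaptedFrame_normal hU hx).mul_orthogonal (h.orthogonal x hx)

theorem ambientForm_normal_pd_pd (h : HasPrincipalForms K U V ρ ω e) (hx : x ∈ U)
    (i j α : Fin n) : ambientForm K (e α x) (pd i (pd j V) x) =
      if i = j then ρ i x * ω x i α else 0 := by
  rw [ambientForm_comm, ambientForm_apply, h.second x hx]

theorem ambientForm_qOf_pd_pd (h : HasPrincipalForms K U V ρ ω e) (hU : IsOpen U) (hx : x ∈ U)
    (i j l : Fin n) : ambientForm K (qOf ρ V l x) (pd i (pd j V) x) =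
      ρ l x * christoffel (inducedMetric K V) l i j x := by
  rw [christoffel_inducedMetric hU h.smooth hx,
    inv_eq_diagonal (h.first x hx) (h.rho_ne_zero x hx), ambientForm_comm, qOf, map_smul,
    smul_eq_mul]
  simp only [Matrix.diagonal_apply, ite_mul, zero_mul, Finset.sum_ite_eq, Finset.mem_univ, if_true]
  have hρ := h.rho_ne_zero x hx l
  field_simp

theorem hasPd_normal (h : HasPrincipalForms K U V ρ ω e) (hK : K * K * K = K) (hU : IsOpen U)
    (hx : x ∈ U) (j α : Fin n) : HasPd j (e α) (-(ω x j α • qOf ρ V j x)) x := by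
  have hA := h.isAdaptedFrame_normal hU hx
  have he := SmoothOn.hasPd (h.frame.smooth α) hU hx j
  have he't := pd_add_smul_mem_spaceFormTangent hK hU hx (h.hasPd hU hx j) h.mem he
    fun y hy => (h.frame.normal y hy α).1
  rw [map_smul, LinearMap.smul_apply, hA.inner_qp, smul_zero, mul_zero, zero_smul, add_zero] at he't
  refine he.congr_deriv (hA.ext he't ((tangentSubmodule K (V x)).neg_mem
    ((tangentSubmodule K (V x)).smul_mem _ (hA.q_tangent j))) (fun β => ?_) fun i => ?_)
  · have hparallel := h.frame.parallel x hx α j _ (h.frame.normal x hx β)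
    rw [ambientForm_comm, ambientForm_apply, hparallel, map_neg, map_smul, hA.inner_pq, smul_zero,
      neg_zero]
  · have hskew := ambientForm_add_eq_zero_of_const hU hx
      (SmoothOn.hasPd (smoothOn_pd h.smooth hU i) hU hx j) he
      fun y hy => (ambientForm_comm _ _).trans ((h.frame.normal y hy α).2 i)
    rw [h.ambientForm_normal_pd_pd hx, h.pd_eq hx, map_smul, LinearMap.smul_apply,
      smul_eq_mul] at hskew
    rw [map_neg, map_smul, hA.inner_qq, smul_eq_mul]
    refine mul_left_cancel₀ (h.rho_ne_zero x hx i) ?_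
    rcases eq_or_ne i j with rfl | hij
    · rw [if_pos rfl] at hskew ⊢
      linear_combination hskew
    · rw [if_neg hij.symm] at hskew
      rw [if_neg hij]
      linear_combination hskew

theorem pd_pd_of_ne (h : HasPrincipalForms K U V ρ ω e) (hK : K * K * K = K) (hU : IsOpen U)
    (hx : x ∈ U) {i j : Fin n} (hij : i ≠ j) : pd j (pd i V) x =
      pd j (ρ i) x • qOf ρ V i x + pd i (ρ j) x • qOf ρ V j x := by
  have hA := h.isAdaptedFrame_normal hU hx
  have hVt := pd_add_smul_mem_spaceFormTangent hK hU hx (h.hasPd hU hx j) h.mem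
    (SmoothOn.hasPd (smoothOn_pd h.smooth hU i) hU hx j)
    fun y hy => pd_mem_spaceFormTangent hU hy (SmoothOn.hasPd h.smooth hU hy i) h.mem
  have horth : ambientForm K (pd j V x) (pd i V x) = 0 :=
    (h.first x hx j i).trans (if_neg hij.symm)
  rw [← h.pd_eq hx, horth, mul_zero, zero_smul, add_zero] at hVt
  refine hA.ext hVt ((tangentSubmodule K (V x)).add_mem
    ((tangentSubmodule K (V x)).smul_mem _ (hA.q_tangent i))
    ((tangentSubmodule K (V x)).smul_mem _ (hA.q_tangent j))) (fun α => ?_) fun l => ?_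
  · rw [h.ambientForm_normal_pd_pd hx, if_neg hij.symm, map_add, map_smul, map_smul, hA.inner_pq,
      hA.inner_pq, smul_zero, smul_zero, add_zero]
  · rw [h.ambientForm_qOf_pd_pd hU hx,
      mul_christoffel_of_diagonal hU h.smooth_rho h.first hx (h.rho_ne_zero x hx), if_neg hij.symm]
    simp only [map_add, map_smul, hA.inner_qq, smul_eq_mul, mul_ite, mul_one, mul_zero, sub_zero,
      @eq_comm _ j l]

theorem hasPd_qOf_of_ne (h : HasPrincipalForms K U V ρ ω e) (hK : K * K * K = K) (hU : IsOpen U)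
    (hx : x ∈ U) {i j : Fin n} (hij : i ≠ j) :
    HasPd j (qOf ρ V i) (-(gammaOf ρ j i x • qOf ρ V j x)) x := by
  refine (((SmoothOn.hasPd (h.smooth_rho i) hU hx j).inv (h.rho_ne_zero x hx i)).smul
    (SmoothOn.hasPd (smoothOn_pd h.smooth hU i) hU hx j)).congr_deriv ?_
  have hρ := h.rho_ne_zero x hx i
  rw [h.pd_pd_of_ne hK hU hx hij, h.pd_eq hx, gammaOf, if_neg hij.symm]
  match_scalars <;> field_simp
  ring

theorem hasPd_omega_of_ne (h : HasPrincipalForms K U V ρ ω e) (hK : K * K * K = K)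
    (hU : IsOpen U) (hx : x ∈ U) {i j : Fin n} (hij : i ≠ j) (α : Fin n) :
    HasPd j (fun y => ω y i α) (-(gammaOf ρ i j x * ω x j α)) x := by
  have hA := h.isAdaptedFrame hU hx
  have hpd {i j : Fin n} (hij : i ≠ j) : pd j (pd i (e α)) x = -(pd j (fun y => ω y i α) x •
      qOf ρ V i x + ω x i α • -(gammaOf ρ j i x • qOf ρ V j x)) := by
    have hωq := (SmoothOn.hasPd (h.smooth_omega i α) hU hx j).smul
      (h.hasPd_qOf_of_ne hK hU hx hij)
    exact ((hωq.clm (-.id ℝ (Ambient n))).congr_of_eqOn hU hx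
      fun y hy => (h.hasPd_normal hK hU hy i α).pd_eq).pd_eq
  have hcomm := congrArg (ambientForm K (qOf ρ V i x)) (pd_comm (h.frame.smooth α) hU hx j i)
  simp only [hpd hij, hpd hij.symm, map_add, map_neg, map_smul, hA.inner_qq, if_true, if_neg hij,
    smul_eq_mul] at hcomm
  refine SmoothOn.hasPd_of_eq (h.smooth_omega i α) hU hx ?_
  linear_combination -hcomm

theorem hasPd_pOf (h : HasPrincipalForms K U V ρ ω e) (hK : K * K * K = K) (hU : IsOpen U)
    (hx : x ∈ U) (i j : Fin n) : HasPd j (pOf ω e i)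
      ((∑ α, pd j (fun y => ω y i α) x • e α x) - (if i = j then 1 else 0 : ℝ) • qOf ρ V j x)
      x := by
  have hωω : ∑ α, ω x i α * ω x j α = if i = j then 1 else 0 := by
    simpa [Matrix.mul_apply, Matrix.one_apply] using
      congrFun₂ ((Matrix.mem_orthogonalGroup_iff (Fin n) ℝ).1 (h.orthogonal x hx)) i j
  refine (HasPd.sum fun α _ => (SmoothOn.hasPd (h.smooth_omega i α) hU hx j).smul
    (h.hasPd_normal hK hU hx j α)).congr_deriv ?_
  rw [Finset.sum_add_distrib, ← hωω, Finset.sum_smul, sub_eq_add_neg, ← Finset.sum_neg_distrib]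
  simp only [smul_neg, smul_smul]

theorem hasPd_pOf_of_ne (h : HasPrincipalForms K U V ρ ω e) (hK : K * K * K = K) (hU : IsOpen U)
    (hx : x ∈ U) {i j : Fin n} (hij : i ≠ j) :
    HasPd j (pOf ω e i) (-(gammaOf ρ i j x • pOf ω e j x)) x := by
  refine (h.hasPd_pOf hK hU hx i j).congr_deriv ?_
  rw [if_neg hij, zero_smul, sub_zero, pOf, Finset.smul_sum, ← Finset.sum_neg_distrib]
  simp only [(h.hasPd_omega_of_ne hK hU hx hij _).pd_eq, neg_smul, smul_smul]

theorem ambientForm_qOf_pd_pOf (h : HasPrincipalForms K U V ρ ω e) (hK : K * K * K = K)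
    (hU : IsOpen U) (hx : x ∈ U) (j : Fin n) :
    ambientForm K (qOf ρ V j x) (pd j (pOf ω e j) x) = -1 := by
  have hA := h.isAdaptedFrame_normal hU hx
  simp [(h.hasPd_pOf hK hU hx j j).pd_eq, hA.inner_qp, hA.inner_qq]

theorem hasRotPd_pOf (h : HasPrincipalForms K U V ρ ω e) (hK : K * K * K = K) (hU : IsOpen U)
    (hx : x ∈ U) (j : Fin n) :
    HasRotPd (fun i => gammaOf ρ i j x) j (pOf ω e) (-((1 : ℝ) • qOf ρ V j x)) x :=
  hasRotPd_p_of_offdiag hK hU hx (fun _ => h.isAdaptedFrame hU)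
    (fun _ => h.hasPd_pOf_of_ne hK hU hx) (fun _ => h.hasPd_qOf_of_ne hK hU hx) (h.hasPd hU hx j)
    (SmoothOn.hasPd (h.smoothOn_pOf j) hU hx j) (h.ambientForm_qOf_pd_pOf hK hU hx j)

theorem hasRotPd_qOf (h : HasPrincipalForms K U V ρ ω e) (hK : K * K * K = K) (hU : IsOpen U)
    (hx : x ∈ U) (j : Fin n) : HasRotPd (fun i => gammaOf ρ j i x) j (qOf ρ V)
      ((1 : ℝ) • pOf ω e j x - (K * ρ j x) • V x) x :=
  hasRotPd_q_of_offdiag hK hU hx (fun _ => h.isAdaptedFrame hU)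
    (fun _ => h.hasPd_pOf_of_ne hK hU hx) (fun _ => h.hasPd_qOf_of_ne hK hU hx) (h.hasPd hU hx j)
    (SmoothOn.hasPd (h.smoothOn_pOf j) hU hx j) (SmoothOn.hasPd (h.smoothOn_qOf hU j) hU hx j)
    (h.ambientForm_qOf_pd_pOf hK hU hx j)

theorem isMovingFrame (h : HasPrincipalForms K U V ρ ω e) (hK : K * K * K = K) (hU : IsOpen U) :
    IsMovingFrame K U ρ (gammaOf ρ) (pOf ω e) (qOf ρ V) V :=
  .of_isAdaptedFrame (.of_hasRotPd h.smoothOn_pOf (h.smoothOn_qOf hU) h.smooth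
    (fun _ => h.hasRotPd_pOf hK hU) (fun _ => h.hasRotPd_qOf hK hU) fun _ => h.hasPd hU)
    fun _ => h.isAdaptedFrame hU

theorem ambientForm_pOf_normal (h : HasPrincipalForms K U V ρ ω e) (hx : x ∈ U) (i α : Fin n) :
    ambientForm K (pOf ω e i x) (e α x) = ω x i α := by
  simp [pOf, ambientForm_apply, h.frame.orthonormal x hx]

theorem hasRotPd_omega (h : HasPrincipalForms K U V ρ ω e) (hK : K * K * K = K) (hU : IsOpen U)
    (hx : x ∈ U) (j α : Fin n) :
    HasRotPd (fun i => gammaOf ρ i j x) j (fun i y => ω y i α) 0 x where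
  offdiag i hij := h.hasPd_omega_of_ne hK hU hx hij α
  diag := by
    have hA := h.isAdaptedFrame_normal hU hx
    refine (((h.hasRotPd_pOf hK hU hx j).diag.inner (K := K)
      (h.hasPd_normal hK hU hx j α)).congr_of_eqOn hU hx
      fun y hy => (h.ambientForm_pOf_normal hy j α).symm).congr_deriv ?_
    simp [h.ambientForm_pOf_normal hx, hA.inner_qp, (h.isAdaptedFrame hU hx).inner_pq]

theorem omegaSystem (h : HasPrincipalForms K U V ρ ω e) (hK : K * K * K = K) (hU : IsOpen U) :
    OmegaSystem U (gammaOf ρ) ω :=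
  .of_hasRotPd h.smooth_omega h.orthogonal fun _ => h.hasRotPd_omega hK hU

theorem gaussCodazzi (h : HasPrincipalForms K U V ρ ω e) (hK : K * K * K = K) (hU : IsOpen U) :
    GaussCodazzi K U ρ (gammaOf ρ) :=
  (h.isMovingFrame hK hU).gaussCodazzi hU h.smooth_rho (h.smoothOn_gammaOf hU)
    fun _ _ _ => if_pos rfl

end HasPrincipalForms

end SpaceFormDarboux

theorem mainTheorem3 {n : ℕ} {K : ℝ} (hK : K = 0 ∨ K = 1 ∨ K = -1) {U : Set (Coord n)}
    (hU : IsOpen U) :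
    -- an immersion in principal coordinates gives a solution of all the equations
    (∀ (V : Coord n → Ambient n) (ρ : Fin n → Coord n → ℝ)
        (ω : Coord n → Matrix (Fin n) (Fin n) ℝ) (e : Fin n → Coord n → Ambient n),
        HasPrincipalForms K U V ρ ω e →
          GaussCodazzi K U ρ (gammaOf ρ) ∧ OmegaSystem U (gammaOf ρ) ω ∧
            IsMovingFrame K U ρ (gammaOf ρ) (pOf ω e) (qOf ρ V) V) ∧
    -- the transformation
    ∀ (μ : ℝ) (ρ : Fin n → Coord n → ℝ) (γ : Fin n → Fin n → Coord n → ℝ)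
      (ξ η : Fin n → Coord n → ℝ) (ζ : Coord n → ℝ),
      GaussCodazzi K U ρ γ → IsDarbouxData K U ρ γ μ ξ η ζ →
      -- new solution of the Gauss-Codazzi equations
      GaussCodazzi K U (rhoT μ ξ ζ ρ) (gammaT μ ξ η γ) ∧
      (∀ ω : Coord n → Matrix (Fin n) (Fin n) ℝ, OmegaSystem U γ ω →
        OmegaSystem U (gammaT μ ξ η γ) (omegaT ξ ω) ∧
        (μ ≠ 0 → ∀ x ∈ U, ∀ i α, ((omegaT ξ ω x i α : ℝ) : ℂ) =
          ∑ j, geoDarboux K μ ξ η ζ 0 x (Sum.inl i) (Sum.inl j) * ((ω x j α : ℝ) : ℂ))) ∧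
      ∀ (p q : Fin n → Coord n → Ambient n) (r : Coord n → Ambient n),
        IsMovingFrame K U ρ γ p q r →
        -- the new frame is `G(1)` applied to the old one
        (∀ x ∈ U, ∀ (a : Idx n) (c : Fin (2 * n + 1)),
          ((column (fun i => pT K μ ξ η ζ p q r i x) (fun i => qT K μ ξ η ζ p q r i x)
              (rT K μ ξ η ζ p q r x) a c : ℝ) : ℂ) =
            ∑ b, geoDarboux K μ ξ η ζ 1 x a b *
              ((column (fun i => p i x) (fun i => q i x) (r x) b c : ℝ) : ℂ)) ∧
        -- new solution of the structure equations
        IsMovingFrame K U (rhoT μ ξ ζ ρ) (gammaT μ ξ η γ)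
          (pT K μ ξ η ζ p q r) (qT K μ ξ η ζ p q r) (rT K μ ξ η ζ p q r) ∧
        -- the new immersion
        (∀ ω : Coord n → Matrix (Fin n) (Fin n) ℝ, OmegaSystem U γ ω →
          HasPrincipalForms K {x ∈ U | ∀ i, rhoT μ ξ ζ ρ i x ≠ 0} (rT K μ ξ η ζ p q r)
              (rhoT μ ξ ζ ρ) (omegaT ξ ω) (normalOf (omegaT ξ ω) (pT K μ ξ η ζ p q r)) ∧
            IsSpaceFormImmersion K {x ∈ U | ∀ i, rhoT μ ξ ζ ρ i x ≠ 0}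
              (rT K μ ξ η ζ p q r)) ∧
        -- the new position vector in terms of the old one
        (∀ x ∈ U, (∀ i, ρ i x ≠ 0) →
          rT K μ ξ η ζ p q r x = positionT K μ ξ η ζ ρ r x) := by
  have hK3 : K * K * K = K := by rcases hK with rfl | rfl | rfl <;> norm_num
  refine ⟨fun V ρ ω e h => ⟨h.gaussCodazzi hK3 hU, h.omegaSystem hK3 hU, h.isMovingFrame hK3 hU⟩,
    fun μ ρ γ ξ η ζ hG hD => ?_⟩
  have hG' := GaussCodazzi.darboux hU hG hD
  refine ⟨hG', fun ω hω => ⟨OmegaSystem.darboux hU hD hω, fun hμ x hx i α =>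
    omegaT_eq_geoDarboux hD hx hμ ω i α⟩, fun p q r hF => ?_⟩
  have hF' := IsMovingFrame.darboux hU hD hK3 hF
  refine ⟨fun x hx a c => frameT_eq_geoDarboux hD hx p q r a c, hF', fun ω hω => ?_,
    fun x hx hρ => rT_eq_positionT hU hG hF.structure_eq hx hρ⟩
  have hW := isOpen_setOf_forall_ne_zero hU fun i => (hG'.smooth_rho i).continuousOn
  have hs : {x ∈ U | ∀ i, rhoT μ ξ ζ ρ i x ≠ 0} ⊆ U := fun x hx => hx.1
  have hω' := (OmegaSystem.darboux hU hD hω).mono hs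
  exact ⟨(hF'.mono hs).hasPrincipalForms hW (hG'.mono hs) hω' fun x hx => hx.2,
    (hF'.mono hs).isSpaceFormImmersion hW (hG'.mono hs) hω' fun x hx => hx.2⟩
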